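/- Let $\mathcal O\subset\mathbb R^d$ be open and bounded and $H=L^2(\mathcal O)$ (infinite dimensional). Let $A:D(A)\subset H\to H$ be self-adjoint and strictly positive definite, with $D(A)$ (graph norm) compactly embedded in $H$; let $0<\lambda_1\le\lambda_2\le\dots$ be its eigenvalues, counted with multiplicity, and $(\tilde e_k)$ a corresponding orthonormal basis of eigenvectors. For $s\in\mathbb R$ put $A^su=\sum_k\lambda_k^s\langle u,\tilde e_k\rangle\tilde e_k$, on its maximal domain $D(A^s)\subset H$, and let $S(t)=e^{-tA}$, $t\ge0$. Let $Q:H\to H$ be bounded, symmetric and nonnegative definite. Noise. Let $\nu$ be a $\sigma$-finite measure on $\mathbb R$ with $\int_{\mathbb R}\max(|\sigma|,\sigma^2)\,\nu(d\sigma)<\infty$, let $\pi$ be a Poisson random measure on $[0,\infty)\times\mathcal O\times\mathbb R$ with reference measure $dt\,d\xi\,\nu(d\sigma)$, and $\hat\pi=\pi-dt\,d\xi\,\nu(d\sigma)$; integrals with respect to $\hat\pi$ of deterministic square integrable functions are $L^2(\mathbb P)$-limits of the integrals of simple functions. For an orthonormal basis $(e_k)$ of $H$ let $Z^{(k)}_t=\int_0^t\int_{\mathcal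 O\times\mathbb R}e_k(\xi)\,\sigma\,\hat\pi(ds,d\xi,d\sigma)$, and write formally $Z_t=\sum_kZ^{(k)}_te_k$. For operators $B$ and operator valued functions $\Psi$ on $H$, $B(Z_t-Z_s)$ means $\sum_k(Z^{(k)}_t-Z^{(k)}_s)Be_k$, and $\int_0^t\Psi(s)\,dZ_s$ means $\sum_k\int_0^t\int_{\mathcal O\times\mathbb R}e_k(\xi)\,\sigma\,\Psi(s)e_k\,\hat\pi(ds,d\xi,d\sigma)$, the series being $L^2(\mathbb P)$-limits. Equation. For $x_0\in H$ let $X_t=S(t)x_0+\int_0^tS(t-s)Q^{1/2}\,dZ_s$, $t\in[0,T]$, be the mild solution of $dX_t+AX_t\,dt=Q^{1/2}\,dZ_t$, $X_0=x_0$. Scheme. Let $(V_h)_{h>0}$ be finite dimensional subspaces of $D(A^{1/2})$, let $P_h$ be the $H$-orthogonal projector onto $V_h$, let $A_h:V_h\to V_h$ be given by $\langle A_hu,v\rangle=\langle A^{1/2}u,A^{1/2}v\rangle$ for $u,v\in V_h$, and $S_h(t)=e^{-tA_h}$. Fix $\theta\in(1/2,1]$; for an integer $N\ge1$ let $\Delta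 t=T/N$, $t_n=n\Delta t$, $T_{h,\Delta t}=(I+\theta\Delta tA_h)^{-1}$, $S_{h,\Delta t}=(I+\theta\Delta tA_h)^{-1}(I-(1-\theta)\Delta tA_h)$ and $$X_h^n=S_{h,\Delta t}^nP_hx_0+\sum_{k=0}^{n-1}S_{h,\Delta t}^{n-k-1}T_{h,\Delta t}P_hQ^{1/2}(Z_{t_{k+1}}-Z_{t_k}),\qquad 0\le n\le N.$$ Assume: (a) for every $q\in[0,2]$ there are constants $\kappa_1,\kappa_2>0$ such that for all $h>0$ and $t>0$ $$\|S_h(t)P_h-S(t)\|_{L(H)}\le\kappa_1h^qt^{-q/2},\qquad \|S_h(t)P_h-S(t)\|_{L(H,D(A^{1/2}))}\le\kappa_2ht^{-1},$$ where $D(A^{1/2})$ carries the graph norm; (b) $\alpha>0$, $\beta\in(\alpha-1,\alpha]$, $\sum_n\lambda_n^{-\alpha}<\infty$, and $A^\beta Q$ is bounded on $H$; (c) $\varphi:H\to\mathbb R$ is twice continuously Fréchet differentiable and bounded together with its first and second derivatives, $D^2\varphi(x)$ is a Hilbert–Schmidt operator for each $x\in H$, and $x\mapsto D^2\varphi(x)$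 is uniformly continuous in the Hilbert–Schmidt norm on bounded subsets of $H$; (d) $T\ge1$. Then for every $\gamma<1-\alpha+\beta$ there is a constant $C>0$ which depends on $x_0$ only through its norm $|x_0|$ (and on the data $\mathcal O,A,Q,\nu,(V_h),\theta,\alpha,\beta,\varphi,T,\gamma$), but not on $h$ and $N$, such that for all $h>0$ and all $N\ge1$ with $\Delta t=T/N\le1$ $$|\mathbb E\varphi(X_h^N)-\mathbb E\varphi(X_T)|\le C\,\bigl(h^{2\gamma}+(\Delta t)^\gamma\bigr).$$ -/

import Mathlib

open MeasureTheory ProbabilityTheory Set Filter Topology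
open scoped NNReal ENNReal

noncomputable section

namespace ImpulsiveHeat

/-! ### The Hilbert space -/

/-- The space `H = L²(O)` of (classes of) real functions on `O ⊆ ℝ^d`. -/
abbrev L2 {d : ℕ} (O : Set (EuclideanSpace ℝ (Fin d))) : Type :=
  Lp ℝ 2 ((volume : Measure (EuclideanSpace ℝ (Fin d))).restrict O)

section Operators

variable {H : Type*} [NormedAddCommGroup H] [InnerProductSpace ℝ H] [CompleteSpace H]

/-! ### Unbounded operators and their powers -/

/-- `A : D(A) ⊆ H → H` is self-adjoint and strictly positive definite, and `D(A)` with the graph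
norm is compactly embedded in `H` (the graph-norm unit ball is relatively compact in `H`). -/
structure IsStrictlyPositiveCompact (A : H →ₗ.[ℝ] H) : Prop where
  selfAdjoint : IsSelfAdjoint A
  pos : ∀ x : A.domain, x ≠ 0 → 0 < inner ℝ (A x) (x : H)
  compact : IsCompact (closure {y : H | ∃ x : A.domain, (x : H) = y ∧ ‖(x : H)‖ + ‖A x‖ ≤ 1})

/-- `lam` is the increasing sequence of the eigenvalues of `A`, with multiplicities, and `e` is a
corresponding orthonormal basis of eigenvectors. -/
structure IsEigenbasis (A : H →ₗ.[ℝ] H) (lam : ℕ → ℝ) (e : HilbertBasis ℕ ℝ H) : Prop where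
  mono : Monotone lam
  eigen : ∀ k, ∃ hk : e k ∈ A.domain, A ⟨e k, hk⟩ = lam k • e k

/-- The subspace `{u | ∑ k, (m k * ⟨u, e k⟩) ^ 2 < ∞}` of `H`. Here `e.repr u k = ⟨e k, u⟩`. -/
def diagDomain (e : HilbertBasis ℕ ℝ H) (m : ℕ → ℝ) : Submodule ℝ H where
  carrier := {u | Memℓp (fun k => m k * e.repr u k) 2}
  add_mem' {u v} hu hv := by
    have h : (fun k => m k * e.repr (u + v) k)
        = (fun k => m k * e.repr u k) + (fun k => m k * e.repr v k) := by
      funext k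
      simp [mul_add]
    change Memℓp _ 2
    rw [h]
    exact Memℓp.add hu hv
  zero_mem' := by
    have h : (fun k => m k * e.repr (0 : H) k) = 0 := by
      funext k
      simp
    change Memℓp _ 2
    rw [h]
    exact zero_memℓp
  smul_mem' c u hu := by
    have h : (fun k => m k * e.repr (c • u) k) = c • (fun k => m k * e.repr u k) := by
      funext k
      simp [mul_left_comm]
    change Memℓp _ 2
    rw [h]
    exact Memℓp.const_smul hu c

/-- The diagonal operator `u ↦ ∑ k, m k * ⟨u, e k⟩ e k`, on its maximal domain. -/
def diagOp (e : HilbertBasis ℕ ℝ H) (m : ℕ → ℝ) : H →ₗ.[ℝ] H where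
  domain := diagDomain e m
  toFun :=
    { toFun := fun u => e.repr.symm ⟨fun k => m k * e.repr (u : H) k, u.2⟩
      map_add' := by
        intro u v
        apply e.repr.injective
        rw [map_add]
        simp only [LinearIsometryEquiv.apply_symm_apply]
        apply lp.ext
        funext k
        rw [lp.coeFn_add, Pi.add_apply]
        simp [mul_add]
      map_smul' := by
        intro c u
        apply e.repr.injective
        rw [RingHom.id_apply, map_smul]
        simp only [LinearIsometryEquiv.apply_symm_apply]
        apply lp.ext
        funext k
        rw [lp.coeFn_smul, Pi.smul_apply]
        simp [mul_left_comm] }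

/-- The power `A ^ s`, `s ∈ ℝ`, of the operator with eigenvalues `lam` and eigenbasis `e`. -/
def powOp (e : HilbertBasis ℕ ℝ H) (lam : ℕ → ℝ) (s : ℝ) : H →ₗ.[ℝ] H :=
  diagOp e (fun k => lam k ^ s)

/-- The semigroup `S(t) = e^{-tA}`, `t ≥ 0`, generated by `-A`:
`S(t) u = ∑ k, e^{-t lam k} ⟨u, e k⟩ e k`. -/
def semigroup (e : HilbertBasis ℕ ℝ H) (lam : ℕ → ℝ) (t : ℝ) (u : H) : H :=
  ∑' k, (Real.exp (-(t * lam k)) * inner ℝ (e k) u) • e k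

/-- `B L` is an everywhere defined bounded operator, where `B` may be unbounded. -/
def IsBoundedComp (B : H →ₗ.[ℝ] H) (L : H →L[ℝ] H) : Prop :=
  ∃ hL : ∀ x, L x ∈ B.domain, ∃ c : ℝ, ∀ x, ‖B ⟨L x, hL x⟩‖ ≤ c * ‖x‖

/-- The square of the Hilbert–Schmidt norm of `L`, computed in the orthonormal basis `e`. -/
def hsNormSq {F : Type*} [NormedAddCommGroup F] [NormedSpace ℝ F]
    (e : HilbertBasis ℕ ℝ H) (L : H →L[ℝ] F) : ℝ≥0∞ :=
  ∑' k, ‖L (e k)‖ₑ ^ 2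

/-! ### Test functions -/

/-- `φ` is twice continuously Fréchet differentiable and bounded with its derivatives of order
one and two; `D²φ(x)` is Hilbert–Schmidt for each `x`, and `x ↦ D²φ(x)` is uniformly continuous
on bounded sets in the Hilbert–Schmidt norm. (`D²φ(x)` is kept as a map from `H` to its dual, which
is isometric to `H`.) -/
structure IsTestFunction (e : HilbertBasis ℕ ℝ H) (φ : H → ℝ) : Prop where
  contDiff : ContDiff ℝ 2 φ
  bdd : ∃ c, ∀ x, ‖φ x‖ ≤ c
  bdd_deriv : ∃ c, ∀ x, ‖fderiv ℝ φ x‖ ≤ c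
  bdd_deriv_two : ∃ c, ∀ x, ‖fderiv ℝ (fderiv ℝ φ) x‖ ≤ c
  hs : ∀ x, hsNormSq e (fderiv ℝ (fderiv ℝ φ) x) < ∞
  hs_unif : ∀ B : Set H, Bornology.IsBounded B → ∀ ε : ℝ, 0 < ε → ∃ δ : ℝ, 0 < δ ∧
    ∀ x ∈ B, ∀ y ∈ B, ‖x - y‖ < δ →
      hsNormSq e (fderiv ℝ (fderiv ℝ φ) x - fderiv ℝ (fderiv ℝ φ) y) < ENNReal.ofReal (ε ^ 2)

/-- The exponential `∑ n, L ^ n / n!` of a bounded operator `L`. -/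
def expOp {E : Type*} [NormedAddCommGroup E] [NormedSpace ℝ E] (L : E →L[ℝ] E) : E →L[ℝ] E :=
  NormedSpace.exp L

/-! ### Discretization operators on a finite dimensional space `W ⊆ D(A^{1/2})` -/

section Discrete

variable (e : HilbertBasis ℕ ℝ H) (lam : ℕ → ℝ) (W : Submodule ℝ H) [FiniteDimensional ℝ W]
  (hW : W ≤ (powOp e lam (1 / 2)).domain)

/-- The restriction of `A^{1/2}` to `W`. -/
def sqrtOn : W →L[ℝ] H :=
  LinearMap.toContinuousLinearMap ((powOp e lam (1 / 2)).toFun ∘ₗ Submodule.inclusion hW)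

/-- The operator `A_h` on `W` with `⟨A_h u, v⟩ = ⟨A^{1/2} u, A^{1/2} v⟩` for `u, v ∈ W`. -/
def discreteOp : W →L[ℝ] W :=
  haveI : CompleteSpace W := FiniteDimensional.complete ℝ W
  (sqrtOn e lam W hW).adjoint ∘L sqrtOn e lam W hW

theorem inner_discreteOp (u v : W) :
    inner ℝ (discreteOp e lam W hW u) v
      = inner ℝ (powOp e lam (1 / 2) ⟨u, hW u.2⟩) (powOp e lam (1 / 2) ⟨v, hW v.2⟩) := by
  have : CompleteSpace W := FiniteDimensional.complete ℝ W
  exact ContinuousLinearMap.adjoint_inner_left (sqrtOn e lam W hW) v (sqrtOn e lam W hW u)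

/-- The orthogonal projector `P_h` of `H` onto `W`. -/
def proj : H →L[ℝ] W := W.orthogonalProjectionOnto

/-- The semigroup `S_h(t) = e^{-t A_h}` on `W`. -/
def discreteSemigroup (t : ℝ) : W →L[ℝ] W :=
  expOp (-(t • discreteOp e lam W hW))

/-- `T_{h,Δt} = (I + θ Δt A_h)⁻¹`. -/
def stepT (θ dt : ℝ) : W →L[ℝ] W :=
  Ring.inverse (1 + (θ * dt) • discreteOp e lam W hW)

/-- `S_{h,Δt} = (I + θ Δt A_h)⁻¹ (I - (1 - θ) Δt A_h)`. -/
def stepS (θ dt : ℝ) : W →L[ℝ] W :=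
  Ring.inverse (1 + (θ * dt) • discreteOp e lam W hW)
    * (1 - ((1 - θ) * dt) • discreteOp e lam W hW)

end Discrete

end Operators

/-! ### Poisson random measures and compensated integrals -/

section Poisson

variable {Ω : Type*} [MeasurableSpace Ω] {E : Type*} [MeasurableSpace E]
  {F : Type*} [NormedAddCommGroup F] [NormedSpace ℝ F]

/-- `π` is a Poisson random measure on `E` with reference (intensity) measure `m`. -/
structure IsPoissonRandomMeasure (m : Measure E) (π : Ω → Measure E) (P : Measure Ω) : Prop where
  measurable : Measurable π
  law : ∀ B, MeasurableSet B → m B ≠ ∞ →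
    P.map (fun ω => π ω B) = (poissonMeasure (m B).toNNReal).map (fun n : ℕ => (n : ℝ≥0∞))
  law_top : ∀ B, MeasurableSet B → m B = ∞ → ∀ᵐ ω ∂P, π ω B = ∞
  indep : ∀ (n : ℕ) (B : Fin n → Set E), (∀ i, MeasurableSet (B i)) →
    Pairwise (fun i j => Disjoint (B i) (B j)) → iIndepFun (fun i ω => π ω (B i)) P

/-- `Y` is the limit of `Yₙ` in `L²(Ω, P; F)`. -/
def IsL2Limit (P : Measure Ω) (Yn : ℕ → Ω → F) (Y : Ω → F) : Prop :=
  MemLp Y 2 P ∧ Tendsto (fun n => eLpNorm (Yn n - Y) 2 P) atTop (𝓝 0)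

/-- `Y = ∫ f dπ̂` with `π̂ = π - m`, for `f ∈ L²(m; F)`: `Y` is the limit in `L²(Ω; F)` of the
integrals `∑ a, (π - m) (fₙ = a) • a` of simple functions `fₙ` that converge to `f` in `L²(m; F)`. -/
def IsCompensatedIntegral (m : Measure E) (π : Ω → Measure E) (P : Measure Ω)
    (f : E → F) (Y : Ω → F) : Prop :=
  MemLp f 2 m ∧ ∃ fn : ℕ → SimpleFunc E F, (∀ n, MemLp (fn n) 2 m) ∧
    Tendsto (fun n => eLpNorm (⇑(fn n) - f) 2 m) atTop (𝓝 0) ∧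
    IsL2Limit P (fun n ω => (fn n).integral (π ω) - (fn n).integral m) Y

end Poisson

/-! ### The impulsive cylindrical process, the equation and the scheme -/

section Scheme

variable {d : ℕ} (O : Set (EuclideanSpace ℝ (Fin d))) (ν : Measure ℝ)

/-- The reference measure `dt dξ ν(dσ)` on `[0,∞) × O × ℝ`. -/
def refMeasure : Measure (ℝ × EuclideanSpace ℝ (Fin d) × ℝ) :=
  (volume.restrict (Ici 0)).prod ((volume.restrict O).prod ν)

variable {Ω : Type*} [MeasurableSpace Ω] (P : Measure Ω)
  (π : Ω → Measure (ℝ × EuclideanSpace ℝ (Fin d) × ℝ)) (b : HilbertBasis ℕ ℝ (L2 O))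
  {F : Type*} [NormedAddCommGroup F] [NormedSpace ℝ F]

/-- `Z k t = Z(t, b k) = ∫_0^t ∫ (b k)(ξ) σ π̂(ds, dξ, dσ)` for `t ∈ [0,T]`: the coordinates, in the
orthonormal basis `b` of `L²(O)`, of the impulsive cylindrical process `Z` with jump size
intensity `ν`. -/
def IsImpulsiveCylindrical (T : ℝ) (Z : ℕ → ℝ → Ω → ℝ) : Prop :=
  ∀ k, ∀ t ∈ Icc 0 T, IsCompensatedIntegral (refMeasure O ν) π P
    ((Icc 0 t ×ˢ univ).indicator (fun p => (b k) p.2.1 * p.2.2)) (Z k t)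

/-- `Y = B (Z_t - Z_s)` for an operator `B : H → F`:
`Y` is the `L²(Ω; F)`-limit of `∑_{k < M} (Z(t, b k) - Z(s, b k)) • B (b k)`. -/
def IsCylindricalIncrement (Z : ℕ → ℝ → Ω → ℝ) (B : L2 O →L[ℝ] F) (s t : ℝ) (Y : Ω → F) : Prop :=
  IsL2Limit P (fun M ω => ∑ k ∈ Finset.range M, (Z k t ω - Z k s ω) • B (b k)) Y

/-- `Y = ∫_0^t Ψ(s) dZ_s` for a deterministic operator valued `Ψ`: `Y` is the `L²(Ω; F)`-limit of
`∑_{k < M} ∫_0^t Ψ(s) (b k) dZ_s(b k)`, where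
`∫_0^t Ψ(s) (b k) dZ_s(b k) = ∫_0^t ∫ (b k)(ξ) σ Ψ(s) (b k) π̂(ds, dξ, dσ)`. -/
def IsCylindricalIntegral (t : ℝ) (Ψ : ℝ → L2 O → F) (Y : Ω → F) : Prop :=
  ∃ I : ℕ → Ω → F,
    (∀ k, IsCompensatedIntegral (refMeasure O ν) π P
      ((Icc 0 t ×ˢ univ).indicator (fun p => ((b k) p.2.1 * p.2.2) • Ψ p.1 (b k))) (I k)) ∧
    IsL2Limit P (fun M ω => ∑ k ∈ Finset.range M, I k ω) Y

variable (e : HilbertBasis ℕ ℝ (L2 O)) (lam : ℕ → ℝ) (R : L2 O →L[ℝ] L2 O)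

/-- `X` is the (mild) solution of `dX_t + A X_t dt = R dZ_t`, `X_0 = x₀`, on `[0,T]`:
`X_t = S(t) x₀ + ∫_0^t S(t-s) R dZ_s` almost surely. -/
def IsMildSolution (T : ℝ) (x₀ : L2 O) (X : ℝ → Ω → L2 O) : Prop :=
  ∀ t ∈ Icc 0 T, ∃ Y : Ω → L2 O,
    IsCylindricalIntegral O ν P π b t (fun s u => semigroup e lam (t - s) (R u)) Y ∧
    ∀ᵐ ω ∂P, X t ω = semigroup e lam t x₀ + Y ω

/-- `X n`, `n = 0, …, N`, is the approximation in the finite dimensional space `W` with time step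
`Δt = T / N`:
`X n = S_{h,Δt}^n P_h x₀ + ∑_{k < n} S_{h,Δt}^{n-k-1} T_{h,Δt} P_h R (Z_{t_{k+1}} - Z_{t_k})`,
where `t_k = k Δt`. -/
def IsDiscreteSolution (Z : ℕ → ℝ → Ω → ℝ) (W : Submodule ℝ (L2 O)) [FiniteDimensional ℝ W]
    (hW : W ≤ (powOp e lam (1 / 2)).domain) (θ T : ℝ) (N : ℕ) (x₀ : L2 O) (X : ℕ → Ω → W) : Prop :=
  ∃ J : ℕ → Ω → W,
    (∀ k < N, IsCylindricalIncrement O P b Z (proj W ∘L R) (k * (T / N)) ((k + 1) * (T / N))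
      (J k)) ∧
    ∀ n ≤ N, ∀ᵐ ω ∂P, X n ω = (stepS e lam W hW θ (T / N) ^ n) (proj W x₀)
      + ∑ k ∈ Finset.range n,
        (stepS e lam W hW θ (T / N) ^ (n - k - 1)) (stepT e lam W hW θ (T / N) (J k ω))

end Scheme

end ImpulsiveHeat

end

open ImpulsiveHeat

/-!
The solution at time `T` and the last value of the scheme are both a deterministic vector plus the
compensated Poisson integral of a deterministic `H`-valued integrand. A compensated integral has
two bounds: the isometry in `L²`, and, because `π` and its intensity `m` are positive measures,

  `E |∫ f d(π - m)| ≤ 2 ∫ |f| dm`   (`IsCompensatedIntegral.eLpNorm_one_le`).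

The second bound is what doubles the order. For the difference of the two integrands,
`f(t, ξ, σ) = ∑ k, b k(ξ) σ G(T - t) R (b k)` with `G(t) = S_{h,Δt}^n T_{h,Δt} P_h - S(t)` on the
`n`-th time step, Parseval's identity in `ξ`, the finiteness of the measure of `O` and of
`∫ |σ| ν(dσ)` turn it into

  `E |X_h^N - X_T| ≤ |(S_{h,Δt}^N P_h - S(T)) x₀| + C ∫_0^T ‖G(t) R‖_HS dt`,

where the Hilbert–Schmidt norm enters to the first power, whereas the isometry would ask for its
square to be integrable in time. So the scheme converges already in `L¹(Ω; H)` with the order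
`γ`, and the claim follows since `φ` is Lipschitz (`exists_strong_error_bound`). If `γ ≤ 0` or
`h ≥ 1` the right-hand side is bounded below and the boundedness of `φ` suffices.

It remains to bound `‖G(t) R‖_HS`. With `p = α - β ∈ [0, 1)`, and since `G` is symmetric,
`‖G R‖_HS ≤ ‖A^{p/2} G‖ ‖A^{-p/2} R‖_HS` (`sum_norm_sq_comp_le`). The last factor is finite because
`|R e_j|² = ⟨Q e_j, e_j⟩ ≤ c lam_j^{-β}` and `∑ lam_j^{-α} < ∞`. Hölder's inequality for the
coefficients in the eigenbasis gives `‖A^{p/2} G‖ ≤ ‖A^{1/2} G‖^p ‖G‖^{1-p}`, so only the cases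
without a fractional power are needed. For the space error they are the smoothing hypotheses on
`S_h(t) P_h - S(t)`; for the time error `A_h` is diagonalized on `V_h`, where
`|A^{1/2} v|² = ⟨A_h v, v⟩`, and the question becomes the scalar estimate `exists_stepErr_bound` for
the stability function of the `θ`-scheme. The outcome is a multiple of
`h^{2γ} t^{-(γ + p)} + Δt^γ t^{-(γ + p/2)}`, which is integrable at `t = 0` because `γ + p < 1`.
-/

set_option linter.unusedSectionVars false

namespace ImpulsiveHeat

/-! ### Moments of the Poisson distribution -/

theorem hasSum_poisson_mean (r : ℝ≥0) :
    HasSum (fun n : ℕ => (Real.exp (-r) * r ^ n / n.factorial) * (n : ℝ)) r := by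
  rw [← hasSum_nat_add_iff' 1]
  have h := (hasSum_one_poissonMeasure r).mul_left (r : ℝ)
  simp only [Finset.range_one, Finset.sum_singleton, CharP.cast_eq_zero, mul_zero, sub_zero]
  rw [mul_one] at h
  refine h.congr_fun ?_
  intro n
  rw [Nat.factorial_succ]
  push_cast
  field_simp
  ring

theorem hasSum_poisson_factorial_moment (r : ℝ≥0) :
    HasSum (fun n : ℕ => (Real.exp (-r) * r ^ n / n.factorial) * ((n : ℝ) * (n - 1))) (r ^ 2) := by
  rw [← hasSum_nat_add_iff' 1]
  have h := (hasSum_poisson_mean r).mul_left (r : ℝ)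
  simp only [Finset.range_one, Finset.sum_singleton, CharP.cast_eq_zero, zero_mul, mul_zero, sub_zero]
  rw [← sq] at h
  refine h.congr_fun ?_
  intro n
  rw [Nat.factorial_succ]
  push_cast
  field_simp
  ring

theorem hasSum_poisson_variance (r : ℝ≥0) :
    HasSum (fun n : ℕ => (Real.exp (-r) * r ^ n / n.factorial) * ((n : ℝ) - r) ^ 2) r := by
  have h := ((hasSum_poisson_factorial_moment r).add
    ((hasSum_poisson_mean r).mul_left (1 - 2 * (r : ℝ)))).add
    ((hasSum_one_poissonMeasure r).mul_left ((r : ℝ) ^ 2))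
  convert h using 1
  · funext n; ring
  · ring

/-! ### Compensated masses of a Poisson random measure -/

section PoissonRandomMeasure

variable {Ω : Type*} [MeasurableSpace Ω] {E : Type*} [MeasurableSpace E]
  {m : Measure E} {π : Ω → Measure E} {P : Measure Ω}

theorem IsPoissonRandomMeasure.measurable_mass (hπ : IsPoissonRandomMeasure m π P) {B : Set E}
    (hB : MeasurableSet B) : Measurable (fun ω => π ω B) :=
  (Measure.measurable_coe hB).comp hπ.measurable

theorem IsPoissonRandomMeasure.measurable_real_mass (hπ : IsPoissonRandomMeasure m π P) {B : Set E}
    (hB : MeasurableSet B) : Measurable (fun ω => (π ω).real B) :=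
  (hπ.measurable_mass hB).ennreal_toReal

/-- Functionals of the mass `π(B)` are integrated against the Poisson distribution. -/
theorem IsPoissonRandomMeasure.lintegral_mass (hπ : IsPoissonRandomMeasure m π P) {B : Set E}
    (hB : MeasurableSet B) (hm : m B ≠ ∞) {g : ℝ≥0∞ → ℝ≥0∞} (hg : Measurable g) :
    ∫⁻ ω, g (π ω B) ∂P = ∫⁻ n : ℕ, g n ∂(poissonMeasure (m B).toNNReal) := by
  have h := hπ.law B hB hm
  rw [← lintegral_map hg (hπ.measurable_mass hB), h, lintegral_map hg (by fun_prop)]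

theorem IsPoissonRandomMeasure.integral_mass (hπ : IsPoissonRandomMeasure m π P) {B : Set E}
    (hB : MeasurableSet B) (hm : m B ≠ ∞) {g : ℝ≥0∞ → ℝ} (hg : Measurable g) :
    ∫ ω, g (π ω B) ∂P = ∫ n : ℕ, g n ∂(poissonMeasure (m B).toNNReal) := by
  have h := hπ.law B hB hm
  rw [← integral_map (hπ.measurable_mass hB).aemeasurable hg.aestronglyMeasurable, h,
    integral_map (Measurable.aemeasurable (by fun_prop)) hg.aestronglyMeasurable]

theorem IsPoissonRandomMeasure.integrable_mass (hπ : IsPoissonRandomMeasure m π P) {B : Set E}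
    (hB : MeasurableSet B) (hm : m B ≠ ∞) {g : ℝ≥0∞ → ℝ} (hg : Measurable g)
    (hi : Integrable (fun n : ℕ => g n) (poissonMeasure (m B).toNNReal)) :
    Integrable (fun ω => g (π ω B)) P := by
  have h := hπ.law B hB hm
  have h2 := (integrable_map_measure (μ := P) (f := fun ω => π ω B) (g := g)
    hg.aestronglyMeasurable (hπ.measurable_mass hB).aemeasurable)
  refine h2.1 ?_
  rw [h]
  exact (integrable_map_measure hg.aestronglyMeasurable
    (Measurable.aemeasurable (by fun_prop))).2 hi

theorem IsPoissonRandomMeasure.integral_real_mass (hπ : IsPoissonRandomMeasure m π P) {B : Set E}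
    (hB : MeasurableSet B) (hm : m B ≠ ∞) :
    Integrable (fun ω => (π ω).real B) P ∧ ∫ ω, (π ω).real B ∂P = m.real B := by
  have hs := hasSum_poisson_mean (m B).toNNReal
  constructor
  · refine hπ.integrable_mass hB hm (g := ENNReal.toReal) ENNReal.measurable_toReal ?_
    rw [integrable_poissonMeasure_iff]
    simpa using hs.summable
  · have := hπ.integral_mass hB hm (g := ENNReal.toReal) ENNReal.measurable_toReal
    rw [show (fun ω => (π ω).real B) = fun ω => (π ω B).toReal from rfl, this,
      integral_poissonMeasure]
    rw [show m.real B = ((m B).toNNReal : ℝ) from rfl]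
    simpa using hs.tsum_eq

theorem IsPoissonRandomMeasure.integral_sq_compensated (hπ : IsPoissonRandomMeasure m π P)
    {B : Set E} (hB : MeasurableSet B) (hm : m B ≠ ∞) :
    Integrable (fun ω => ((π ω).real B - m.real B) ^ 2) P ∧
      ∫ ω, ((π ω).real B - m.real B) ^ 2 ∂P = m.real B := by
  have hs := hasSum_poisson_variance (m B).toNNReal
  have hg : Measurable (fun x : ℝ≥0∞ => (x.toReal - m.real B) ^ 2) := by fun_prop
  have hr : m.real B = ((m B).toNNReal : ℝ) := rfl
  constructor
  · refine hπ.integrable_mass hB hm hg ?_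
    rw [integrable_poissonMeasure_iff]
    simpa [hr] using hs.summable
  · have := hπ.integral_mass hB hm hg
    rw [show (fun ω => ((π ω).real B - m.real B) ^ 2)
      = fun ω => ((π ω B).toReal - m.real B) ^ 2 from rfl, this, integral_poissonMeasure]
    simpa [hr] using hs.tsum_eq

theorem IsPoissonRandomMeasure.lintegral_mass_eq (hπ : IsPoissonRandomMeasure m π P)
    {B : Set E} (hB : MeasurableSet B) (hm : m B ≠ ∞) : ∫⁻ ω, π ω B ∂P = m B := by
  have hs := hasSum_poisson_mean (m B).toNNReal
  rw [hπ.lintegral_mass hB hm (g := fun x => x) measurable_id, lintegral_countable']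
  simp_rw [poissonMeasure_singleton]
  have : ∀ n : ℕ, (n : ℝ≥0∞) * ENNReal.ofReal
      (Real.exp (-((m B).toNNReal : ℝ)) * ((m B).toNNReal : ℝ) ^ n / n.factorial)
      = ENNReal.ofReal ((Real.exp (-((m B).toNNReal : ℝ)) * ((m B).toNNReal : ℝ) ^ n
        / n.factorial) * n) := by
    intro n
    rw [mul_comm, ENNReal.ofReal_mul (by positivity), ENNReal.ofReal_natCast]
  simp_rw [this]
  rw [← ENNReal.ofReal_tsum_of_nonneg (fun n => by positivity) hs.summable, hs.tsum_eq]
  simp [hm]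

theorem IsPoissonRandomMeasure.ae_mass_lt_top (hπ : IsPoissonRandomMeasure m π P)
    {B : Set E} (hB : MeasurableSet B) (hm : m B ≠ ∞) : ∀ᵐ ω ∂P, π ω B < ∞ := by
  refine ae_lt_top (hπ.measurable_mass hB) ?_
  rw [hπ.lintegral_mass_eq hB hm]
  exact hm

/-- The compensated masses of disjoint sets are uncorrelated. -/
theorem IsPoissonRandomMeasure.integral_mul_compensated [IsProbabilityMeasure P]
    (hπ : IsPoissonRandomMeasure m π P)
    {B B' : Set E} (hB : MeasurableSet B) (hB' : MeasurableSet B') (hd : Disjoint B B')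
    (hm : m B ≠ ∞) :
    ∫ ω, ((π ω).real B - m.real B) * ((π ω).real B' - m.real B') ∂P = 0 := by
  have hI := hπ.indep 2 ![B, B'] (by intro i; fin_cases i <;> simp [hB, hB']) (by
    intro i j hij
    fin_cases i <;> fin_cases j <;> simp_all [disjoint_comm])
  have hI2 : IndepFun (fun ω => π ω B) (fun ω => π ω B') P := by
    simpa using hI.indepFun (i := 0) (j := 1) (by simp)
  have hI3 := hI2.comp (φ := fun x => x.toReal - m.real B) (ψ := fun x => x.toReal - m.real B')
    (by fun_prop) (by fun_prop)
  have h1 := hI3.integral_fun_mul_eq_mul_integral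
    (((hπ.measurable_mass hB).ennreal_toReal.sub_const _).aestronglyMeasurable)
    (((hπ.measurable_mass hB').ennreal_toReal.sub_const _).aestronglyMeasurable)
  have h0 : ∫ ω, ((π ω).real B - m.real B) ∂P = 0 := by
    rw [integral_sub (hπ.integral_real_mass hB hm).1 (integrable_const _),
      (hπ.integral_real_mass hB hm).2]
    simp
  have h2 : ∫ ω, ((fun x : ℝ≥0∞ => x.toReal - m.real B) ∘ fun ω => π ω B) ω ∂P = 0 := h0
  rw [h2, zero_mul] at h1
  exact h1

theorem IsPoissonRandomMeasure.memLp_compensated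
    (hπ : IsPoissonRandomMeasure m π P)
    {B : Set E} (hB : MeasurableSet B) (hm : m B ≠ ∞) :
    MemLp (fun ω => (π ω).real B - m.real B) 2 P :=
  (memLp_two_iff_integrable_sq
    ((hπ.measurable_real_mass hB).sub_const _).aestronglyMeasurable).2
    (hπ.integral_sq_compensated hB hm).1

end PoissonRandomMeasure

/-! ### Compensated integrals of simple functions -/

section CompensatedIntegral

open scoped Classical

variable {Ω : Type*} [MeasurableSpace Ω] {E : Type*} [MeasurableSpace E]
  {m : Measure E} {π : Ω → Measure E} {P : Measure Ω}

/-- The compensated integral `∫ g d(π - m)` of a simple function `g`, as a random variable. -/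
noncomputable def simpleCompInt {F : Type*} [NormedAddCommGroup F] [NormedSpace ℝ F] (m : Measure E)
    (π : Ω → Measure E) (g : SimpleFunc E F) (ω : Ω) : F :=
  g.integral (π ω) - g.integral m

section Normed

variable {F : Type*} [NormedAddCommGroup F] [NormedSpace ℝ F]
  {F' : Type*} [NormedAddCommGroup F'] [NormedSpace ℝ F']

theorem simpleCompInt_eq_sum (g : SimpleFunc E F) (ω : Ω) :
    simpleCompInt m π g ω = ∑ x ∈ g.range with x ≠ 0,
      ((π ω).real (g ⁻¹' {x}) - m.real (g ⁻¹' {x})) • x := by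
  rw [simpleCompInt, SimpleFunc.integral_eq, SimpleFunc.integral_eq, ← Finset.sum_sub_distrib,
    Finset.sum_filter]
  refine Finset.sum_congr rfl fun x _ => ?_
  by_cases hx : x = 0
  · simp [hx]
  · simp [hx, sub_smul]

theorem measure_preimage_ne_top_of_memLp_two {g : SimpleFunc E F} (hg : MemLp g 2 m) {x : F}
    (hx : x ≠ 0) : m (g ⁻¹' {x}) ≠ ∞ :=
  (SimpleFunc.measure_preimage_lt_top_of_memLp (by norm_num) (by norm_num) g hg x hx).ne

theorem IsPoissonRandomMeasure.ae_integrable (hπ : IsPoissonRandomMeasure m π P)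
    {g : SimpleFunc E F} (hg : MemLp g 2 m) : ∀ᵐ ω ∂P, Integrable g (π ω) := by
  have h : ∀ᵐ ω ∂P, ∀ x ∈ g.range, x ≠ 0 → π ω (g ⁻¹' {x}) < ∞ := by
    rw [Filter.eventually_all_finset]
    intro x _
    by_cases hx : x = 0
    · simp [hx]
    · filter_upwards [hπ.ae_mass_lt_top (g.measurableSet_preimage {x})
        (measure_preimage_ne_top_of_memLp_two hg hx)] with ω hω _ using hω
  filter_upwards [h] with ω hω
  rw [SimpleFunc.integrable_iff]
  intro x hx
  by_cases hxr : x ∈ g.range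
  · exact hω x hxr hx
  · have : g ⁻¹' {x} = ∅ := by
      ext p
      simp only [mem_preimage, mem_singleton_iff, mem_empty_iff_false, iff_false]
      intro h
      exact hxr (h ▸ g.mem_range_self p)
    simp [this]

theorem integrable_of_memLp_two {g : SimpleFunc E F} (hg : MemLp g 2 m) : Integrable g m := by
  rw [SimpleFunc.integrable_iff]
  exact fun x hx => (measure_preimage_ne_top_of_memLp_two hg hx).lt_top

theorem simpleCompInt_add (hπ : IsPoissonRandomMeasure m π P) {g g' : SimpleFunc E F}
    (hg : MemLp g 2 m) (hg' : MemLp g' 2 m) :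
    simpleCompInt m π (g + g') =ᵐ[P] simpleCompInt m π g + simpleCompInt m π g' := by
  filter_upwards [hπ.ae_integrable hg, hπ.ae_integrable hg'] with ω h h'
  simp only [simpleCompInt, Pi.add_apply]
  rw [SimpleFunc.integral_add h h', SimpleFunc.integral_add (integrable_of_memLp_two hg)
    (integrable_of_memLp_two hg')]
  abel

theorem simpleCompInt_sub (hπ : IsPoissonRandomMeasure m π P) {g g' : SimpleFunc E F}
    (hg : MemLp g 2 m) (hg' : MemLp g' 2 m) :
    simpleCompInt m π (g - g') =ᵐ[P] simpleCompInt m π g - simpleCompInt m π g' := by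
  filter_upwards [hπ.ae_integrable hg, hπ.ae_integrable hg'] with ω h h'
  simp only [simpleCompInt, Pi.sub_apply]
  rw [SimpleFunc.integral_sub h h', SimpleFunc.integral_sub (integrable_of_memLp_two hg)
    (integrable_of_memLp_two hg')]
  abel

theorem simpleCompInt_map (hπ : IsPoissonRandomMeasure m π P) {g : SimpleFunc E F}
    (hg : MemLp g 2 m) (L : F →L[ℝ] F') :
    simpleCompInt m π (g.map L) =ᵐ[P] fun ω => L (simpleCompInt m π g ω) := by
  filter_upwards [hπ.ae_integrable hg] with ω h
  simp only [simpleCompInt]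
  rw [SimpleFunc.map_integral _ _ h (map_zero L),
    SimpleFunc.map_integral _ _ (integrable_of_memLp_two hg) (map_zero L), map_sub,
    SimpleFunc.integral_eq, SimpleFunc.integral_eq]
  simp

/-- The `L¹` bound `E |∫ g d(π - m)| ≤ 2 ∫ |g| dm`: both `π` and `m` are positive measures, and the
intensity of `π` is `m`. -/
theorem eLpNorm_one_simpleCompInt_le [IsProbabilityMeasure P] (hπ : IsPoissonRandomMeasure m π P)
    {g : SimpleFunc E F} (hg : MemLp g 2 m) :
    eLpNorm (simpleCompInt m π g) 1 P ≤ 2 * eLpNorm g 1 m := by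
  rw [eLpNorm_one_eq_lintegral_enorm, eLpNorm_one_eq_lintegral_enorm]
  have hpt : ∀ ω, ‖simpleCompInt m π g ω‖ₑ ≤ ∑ x ∈ g.range with x ≠ 0,
      (π ω (g ⁻¹' {x}) + m (g ⁻¹' {x})) * ‖x‖ₑ := by
    intro ω
    rw [simpleCompInt_eq_sum]
    refine (enorm_sum_le _ _).trans (Finset.sum_le_sum fun x _ => ?_)
    rw [enorm_smul]
    gcongr
    refine enorm_sub_le.trans ?_
    gcongr
    · rw [Real.enorm_of_nonneg measureReal_nonneg]
      exact ENNReal.ofReal_toReal_le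
    · rw [Real.enorm_of_nonneg measureReal_nonneg]
      exact ENNReal.ofReal_toReal_le
  have hg1 : ∫⁻ p, ‖g p‖ₑ ∂m = ∑ x ∈ g.range with x ≠ 0, ‖x‖ₑ * m (g ⁻¹' {x}) := by
    have h1 : ∫⁻ p, ‖g p‖ₑ ∂m = (g.map (fun x => ‖x‖ₑ)).lintegral m := by
      rw [← SimpleFunc.lintegral_eq_lintegral]
      rfl
    rw [h1, SimpleFunc.map_lintegral, Finset.sum_filter]
    refine Finset.sum_congr rfl fun x _ => ?_
    by_cases hx : x = 0 <;> simp [hx]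
  calc ∫⁻ ω, ‖simpleCompInt m π g ω‖ₑ ∂P
      ≤ ∫⁻ ω, ∑ x ∈ g.range with x ≠ 0, (π ω (g ⁻¹' {x}) + m (g ⁻¹' {x})) * ‖x‖ₑ ∂P :=
        lintegral_mono hpt
    _ = ∑ x ∈ g.range with x ≠ 0, ∫⁻ ω, (π ω (g ⁻¹' {x}) + m (g ⁻¹' {x})) * ‖x‖ₑ ∂P :=
        lintegral_finsetSum _ fun x _ =>
          ((hπ.measurable_mass (g.measurableSet_preimage {x})).add_const _).mul_const _
    _ = ∑ x ∈ g.range with x ≠ 0, 2 * (‖x‖ₑ * m (g ⁻¹' {x})) := by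
        refine Finset.sum_congr rfl fun x hx => ?_
        have hmx := measure_preimage_ne_top_of_memLp_two hg (Finset.mem_filter.1 hx).2
        have hB := g.measurableSet_preimage {x}
        rw [lintegral_mul_const _ ((hπ.measurable_mass hB).add_const _),
          lintegral_add_right _ measurable_const, hπ.lintegral_mass_eq hB hmx]
        simp
        ring
    _ = 2 * ∫⁻ p, ‖g p‖ₑ ∂m := by rw [hg1, Finset.mul_sum]

end Normed

section Inner

variable {F : Type*} [NormedAddCommGroup F] [InnerProductSpace ℝ F]

theorem memLp_simpleCompInt [IsProbabilityMeasure P] (hπ : IsPoissonRandomMeasure m π P)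
    {g : SimpleFunc E F} (hg : MemLp g 2 m) : MemLp (simpleCompInt m π g) 2 P := by
  have : simpleCompInt m π g = fun ω => ∑ x ∈ g.range with x ≠ 0,
      ((π ω).real (g ⁻¹' {x}) - m.real (g ⁻¹' {x})) • x := by
    funext ω
    exact simpleCompInt_eq_sum g ω
  rw [this]
  refine memLp_finsetSum _ fun x hx => ?_
  have hmx := measure_preimage_ne_top_of_memLp_two hg (Finset.mem_filter.1 hx).2
  have hc := hπ.memLp_compensated (g.measurableSet_preimage {x}) hmx
  exact ((ContinuousLinearMap.toSpanSingleton ℝ x).comp_memLp' hc)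

/-- The Itô isometry for simple functions. -/
theorem integral_norm_sq_simpleCompInt [IsProbabilityMeasure P]
    (hπ : IsPoissonRandomMeasure m π P) {g : SimpleFunc E F} (hg : MemLp g 2 m) :
    ∫ ω, ‖simpleCompInt m π g ω‖ ^ 2 ∂P = ∫ p, ‖g p‖ ^ 2 ∂m := by
  set s := g.range.filter (fun x => x ≠ 0) with hs
  set c : F → Ω → ℝ := fun x ω => (π ω).real (g ⁻¹' {x}) - m.real (g ⁻¹' {x}) with hc
  have hmx : ∀ x ∈ s, m (g ⁻¹' {x}) ≠ ∞ := fun x hx =>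
    measure_preimage_ne_top_of_memLp_two hg (Finset.mem_filter.1 hx).2
  have hcL : ∀ x ∈ s, MemLp (c x) 2 P := fun x hx =>
    hπ.memLp_compensated (g.measurableSet_preimage {x}) (hmx x hx)
  have h1 : ∀ ω, ‖simpleCompInt m π g ω‖ ^ 2 =
      ∑ x ∈ s, ∑ y ∈ s, (c x ω * c y ω) * inner ℝ x y := by
    intro ω
    rw [simpleCompInt_eq_sum, ← real_inner_self_eq_norm_sq, sum_inner]
    refine Finset.sum_congr rfl fun x _ => ?_
    rw [inner_sum]
    refine Finset.sum_congr rfl fun y _ => ?_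
    rw [real_inner_smul_left, real_inner_smul_right]
    ring
  have h2 : ∀ p, ‖g p‖ ^ 2 = ∑ x ∈ s, (g ⁻¹' {x}).indicator (fun _ => ‖x‖ ^ 2) p := by
    intro p
    by_cases hp : g p = 0
    · rw [hp, norm_zero, Finset.sum_eq_zero]
      · simp
      · intro x hx
        refine indicator_of_notMem ?_ _
        simp only [mem_preimage, mem_singleton_iff]
        intro h
        exact (Finset.mem_filter.1 hx).2 (h ▸ hp)
    · rw [Finset.sum_eq_single_of_mem (g p) (Finset.mem_filter.2 ⟨g.mem_range_self p, hp⟩)]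
      · rw [indicator_of_mem (by simp)]
      · intro x _ hx
        refine indicator_of_notMem ?_ _
        simp only [mem_preimage, mem_singleton_iff]
        exact fun h => hx h.symm
  have hint : ∀ x ∈ s, ∀ y ∈ s, Integrable (fun ω => (c x ω * c y ω) * inner ℝ x y) P :=
    fun x hx y hy => (MemLp.integrable_mul (hcL x hx) (hcL y hy)).mul_const _
  simp_rw [h1, h2]
  rw [integral_finsetSum _ fun x hx => integrable_finsetSum _ fun y hy => hint x hx y hy,
    integral_finsetSum]
  · refine Finset.sum_congr rfl fun x hx => ?_
    rw [integral_finsetSum _ fun y hy => hint x hx y hy, Finset.sum_eq_single_of_mem x hx]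
    · rw [integral_mul_const, real_inner_self_eq_norm_sq,
        integral_indicator_const _ (g.measurableSet_preimage {x})]
      have := (hπ.integral_sq_compensated (g.measurableSet_preimage {x}) (hmx x hx)).2
      simp_rw [sq] at this
      rw [this, smul_eq_mul]
    · intro y hy hyx
      have hd : Disjoint (g ⁻¹' {x}) (g ⁻¹' {y}) :=
        Disjoint.preimage _ (by simpa using hyx.symm)
      rw [integral_mul_const, hπ.integral_mul_compensated (g.measurableSet_preimage {x})
        (g.measurableSet_preimage {y}) hd (hmx x hx), zero_mul]
  · intro x hx
    exact (integrable_indicator_iff (g.measurableSet_preimage {x})).2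
      (integrableOn_const (hmx x hx))

theorem eLpNorm_two_simpleCompInt [IsProbabilityMeasure P] (hπ : IsPoissonRandomMeasure m π P)
    {g : SimpleFunc E F} (hg : MemLp g 2 m) :
    eLpNorm (simpleCompInt m π g) 2 P = eLpNorm g 2 m := by
  rw [(memLp_simpleCompInt hπ hg).eLpNorm_eq_integral_rpow_norm (by norm_num) (by norm_num),
    hg.eLpNorm_eq_integral_rpow_norm (by norm_num) (by norm_num)]
  have := integral_norm_sq_simpleCompInt hπ hg
  simp only [ENNReal.toReal_ofNat, Real.rpow_ofNat]
  rw [this]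

end Inner

end CompensatedIntegral

/-! ### Limits in `L²` and compensated integrals -/

section CompensatedIntegral

variable {Ω : Type*} [MeasurableSpace Ω] {E : Type*} [MeasurableSpace E]
  {m : Measure E} {π : Ω → Measure E} {P : Measure Ω}

section Normed

variable {F : Type*} [NormedAddCommGroup F] [NormedSpace ℝ F]
  {F' : Type*} [NormedAddCommGroup F'] [NormedSpace ℝ F']

theorem tendsto_eLpNorm_add {f g : ℕ → E → F} {f' g' : E → F} {p : ℝ≥0∞} (hp : 1 ≤ p)
    (hfm : ∀ n, AEStronglyMeasurable (f n - f') m) (hgm : ∀ n, AEStronglyMeasurable (g n - g') m)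
    (hf : Tendsto (fun n => eLpNorm (f n - f') p m) atTop (𝓝 0))
    (hg : Tendsto (fun n => eLpNorm (g n - g') p m) atTop (𝓝 0)) :
    Tendsto (fun n => eLpNorm (f n + g n - (f' + g')) p m) atTop (𝓝 0) := by
  have h := hf.add hg
  rw [add_zero] at h
  refine tendsto_of_tendsto_of_tendsto_of_le_of_le tendsto_const_nhds h (fun _ => zero_le) ?_
  intro n
  have : f n + g n - (f' + g') = (f n - f') + (g n - g') := by abel
  simp only [this]
  exact eLpNorm_add_le (hfm n) (hgm n) hp

theorem tendsto_eLpNorm_clm (L : F →L[ℝ] F') {f : ℕ → E → F} {f' : E → F} {p : ℝ≥0∞}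
    (hf : Tendsto (fun n => eLpNorm (f n - f') p m) atTop (𝓝 0)) :
    Tendsto (fun n => eLpNorm ((fun x => L (f n x)) - fun x => L (f' x)) p m) atTop (𝓝 0) := by
  have h : Tendsto (fun n => ENNReal.ofReal ‖L‖ * eLpNorm (f n - f') p m) atTop (𝓝 0) := by
    have := ENNReal.Tendsto.const_mul (a := ENNReal.ofReal ‖L‖) hf (Or.inr ENNReal.ofReal_ne_top)
    rwa [mul_zero] at this
  refine tendsto_of_tendsto_of_tendsto_of_le_of_le tendsto_const_nhds h (fun _ => zero_le) ?_
  intro n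
  refine eLpNorm_le_mul_eLpNorm_of_ae_le_mul (ae_of_all _ fun x => ?_) p
  simp only [Pi.sub_apply, ← map_sub]
  exact L.le_opNorm _

theorem IsL2Limit.congr {Yn Yn' : ℕ → Ω → F} {Y Y' : Ω → F} (h : IsL2Limit P Yn Y)
    (hn : ∀ n, Yn n =ᵐ[P] Yn' n) (hY : Y =ᵐ[P] Y') : IsL2Limit P Yn' Y' := by
  refine ⟨(memLp_congr_ae hY).1 h.1, h.2.congr fun n => ?_⟩
  exact eLpNorm_congr_ae ((hn n).sub hY)

theorem IsL2Limit.add {Yn Yn' : ℕ → Ω → F} {Y Y' : Ω → F} (h : IsL2Limit P Yn Y)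
    (h' : IsL2Limit P Yn' Y') (hm : ∀ n, AEStronglyMeasurable (Yn n) P)
    (hm' : ∀ n, AEStronglyMeasurable (Yn' n) P) :
    IsL2Limit P (fun n => Yn n + Yn' n) (Y + Y') :=
  ⟨h.1.add h'.1, tendsto_eLpNorm_add (by norm_num) (fun n => (hm n).sub h.1.1)
    (fun n => (hm' n).sub h'.1.1) h.2 h'.2⟩

theorem IsL2Limit.clm {Yn : ℕ → Ω → F} {Y : Ω → F} (h : IsL2Limit P Yn Y) (L : F →L[ℝ] F') :
    IsL2Limit P (fun n ω => L (Yn n ω)) (fun ω => L (Y ω)) :=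
  ⟨L.comp_memLp' h.1, tendsto_eLpNorm_clm L h.2⟩

theorem IsL2Limit.sum {ι : Type*} (s : Finset ι) {Yn : ι → ℕ → Ω → F} {Y : ι → Ω → F}
    (h : ∀ i ∈ s, IsL2Limit P (Yn i) (Y i))
    (hm : ∀ i ∈ s, ∀ n, AEStronglyMeasurable (Yn i n) P) :
    IsL2Limit P (fun n => ∑ i ∈ s, Yn i n) (∑ i ∈ s, Y i) := by
  classical
  induction s using Finset.induction_on with
  | empty => exact ⟨by simp, by simp⟩
  | insert a s ha ih =>
    simp only [Finset.sum_insert ha]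
    refine (h a (by simp)).add (ih (fun i hi => h i (by simp [hi]))
      fun i hi => hm i (by simp [hi])) (hm a (by simp)) fun n => ?_
    exact Finset.aestronglyMeasurable_sum _ fun i hi => hm i (by simp [hi]) n

/-- An `L¹` bound passes to `L²`-limits on a probability space. -/
theorem IsL2Limit.eLpNorm_one_le [IsProbabilityMeasure P] {Yn : ℕ → Ω → F} {Y : Ω → F}
    (h : IsL2Limit P Yn Y) (hm : ∀ n, AEStronglyMeasurable (Yn n) P) {K : ℝ≥0∞} {k : ℕ → ℝ≥0∞}
    (hk : Tendsto k atTop (𝓝 K)) (hK : ∀ n, eLpNorm (Yn n) 1 P ≤ k n) : eLpNorm Y 1 P ≤ K := by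
  have ht := h.2.add hk
  rw [zero_add] at ht
  refine ge_of_tendsto' ht fun n => ?_
  have hY : Y = Yn n - (Yn n - Y) := by abel
  calc eLpNorm Y 1 P = eLpNorm (Yn n - (Yn n - Y)) 1 P := by rw [← hY]
    _ ≤ eLpNorm (Yn n) 1 P + eLpNorm (Yn n - Y) 1 P :=
        eLpNorm_sub_le (hm n) ((hm n).sub h.1.1) le_rfl
    _ ≤ k n + eLpNorm (Yn n - Y) 2 P :=
        add_le_add (hK n) (eLpNorm_le_eLpNorm_of_exponent_le (by norm_num) ((hm n).sub h.1.1))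
    _ = _ := add_comm _ _

theorem isCompensatedIntegral_zero :
    IsCompensatedIntegral m π P (0 : E → F) (0 : Ω → F) := by
  refine ⟨by simp, fun _ => 0, by simp, by simp, by simp, ?_⟩
  have h0 : ∀ μ : Measure E, (0 : SimpleFunc E F).integral μ = 0 := by
    intro μ
    rw [SimpleFunc.integral_eq]
    refine Finset.sum_eq_zero fun x hx => ?_
    obtain ⟨y, rfl⟩ := SimpleFunc.mem_range.1 hx
    simp
  have : (fun (_ : ℕ) (ω : Ω) => (0 : SimpleFunc E F).integral (π ω)
      - (0 : SimpleFunc E F).integral m) = fun _ => 0 := by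
    funext n ω
    simp [h0]
  rw [this]
  simp

theorem IsCompensatedIntegral.congr {f f' : E → F} {Y Y' : Ω → F}
    (h : IsCompensatedIntegral m π P f Y) (hf : f =ᵐ[m] f') (hY : Y =ᵐ[P] Y') :
    IsCompensatedIntegral m π P f' Y' := by
  obtain ⟨h1, fn, h2, h3, h4⟩ := h
  refine ⟨(memLp_congr_ae hf).1 h1, fn, h2, h3.congr fun n => ?_, h4.congr (fun n => ae_eq_rfl) hY⟩
  exact eLpNorm_congr_ae (ae_eq_rfl.sub hf)

theorem IsCompensatedIntegral.clm (hπ : IsPoissonRandomMeasure m π P) {f : E → F} {Y : Ω → F}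
    (h : IsCompensatedIntegral m π P f Y) (L : F →L[ℝ] F') :
    IsCompensatedIntegral m π P (fun p => L (f p)) (fun ω => L (Y ω)) := by
  obtain ⟨h1, fn, h2, h3, h4⟩ := h
  refine ⟨L.comp_memLp' h1, fun n => (fn n).map L, fun n => L.comp_memLp' (h2 n),
    tendsto_eLpNorm_clm L h3, (h4.clm L).congr (fun n => ?_) ae_eq_rfl⟩
  exact (simpleCompInt_map hπ (h2 n) L).symm

end Normed

section Inner

variable {F : Type*} [NormedAddCommGroup F] [InnerProductSpace ℝ F]
  [IsProbabilityMeasure P]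

theorem IsCompensatedIntegral.add (hπ : IsPoissonRandomMeasure m π P) {f f' : E → F} {Y Y' : Ω → F}
    (h : IsCompensatedIntegral m π P f Y) (h' : IsCompensatedIntegral m π P f' Y') :
    IsCompensatedIntegral m π P (f + f') (Y + Y') := by
  obtain ⟨h1, fn, h2, h3, h4⟩ := h
  obtain ⟨h1', fn', h2', h3', h4'⟩ := h'
  refine ⟨h1.add h1', fun n => fn n + fn' n, fun n => (h2 n).add (h2' n), ?_, ?_⟩
  · exact tendsto_eLpNorm_add (by norm_num) (fun n => (h2 n).1.sub h1.1)
      (fun n => (h2' n).1.sub h1'.1) h3 h3'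
  · refine (h4.add h4' (fun n => (memLp_simpleCompInt hπ (h2 n)).1)
      (fun n => (memLp_simpleCompInt hπ (h2' n)).1)).congr (fun n => ?_) ae_eq_rfl
    exact (simpleCompInt_add hπ (h2 n) (h2' n)).symm

theorem IsCompensatedIntegral.sub (hπ : IsPoissonRandomMeasure m π P) {f f' : E → F} {Y Y' : Ω → F}
    (h : IsCompensatedIntegral m π P f Y) (h' : IsCompensatedIntegral m π P f' Y') :
    IsCompensatedIntegral m π P (f - f') (Y - Y') := by
  have h2 := h.add hπ (h'.clm hπ (-ContinuousLinearMap.id ℝ F))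
  refine h2.congr (ae_of_all _ fun p => ?_) (ae_of_all _ fun ω => ?_) <;> simp [sub_eq_add_neg]

theorem IsCompensatedIntegral.sum (hπ : IsPoissonRandomMeasure m π P) {ι : Type*} (s : Finset ι)
    {f : ι → E → F} {Y : ι → Ω → F} (h : ∀ i ∈ s, IsCompensatedIntegral m π P (f i) (Y i)) :
    IsCompensatedIntegral m π P (∑ i ∈ s, f i) (∑ i ∈ s, Y i) := by
  classical
  induction s using Finset.induction_on with
  | empty => simpa using isCompensatedIntegral_zero
  | insert a s ha ih =>
    rw [Finset.sum_insert ha, Finset.sum_insert ha]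
    exact (h a (by simp)).add hπ (ih fun i hi => h i (by simp [hi]))

/-- By the isometry, the compensated integral does not depend on the approximating sequence. -/
theorem IsCompensatedIntegral.isL2Limit (hπ : IsPoissonRandomMeasure m π P) {f : E → F} {Y : Ω → F}
    (h : IsCompensatedIntegral m π P f Y) {gn : ℕ → SimpleFunc E F} (hg : ∀ n, MemLp (gn n) 2 m)
    (ht : Tendsto (fun n => eLpNorm (⇑(gn n) - f) 2 m) atTop (𝓝 0)) :
    IsL2Limit P (fun n => simpleCompInt m π (gn n)) Y := by
  obtain ⟨h1, fn, h2, h3, h4⟩ := h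
  refine ⟨h4.1, ?_⟩
  have hs := (ht.add h3).add h4.2
  simp only [add_zero] at hs
  refine tendsto_of_tendsto_of_tendsto_of_le_of_le tendsto_const_nhds hs (fun _ => zero_le) ?_
  intro n
  have hmf := (memLp_simpleCompInt (P := P) hπ (h2 n)).1
  have hmg := (memLp_simpleCompInt (P := P) hπ (hg n)).1
  have e1 : simpleCompInt m π (gn n) - Y = (simpleCompInt m π (gn n) - simpleCompInt m π (fn n))
      + (simpleCompInt m π (fn n) - Y) := by abel
  have e2 : (gn n : E → F) - fn n = (⇑(gn n) - f) - (⇑(fn n) - f) := by abel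
  calc eLpNorm (simpleCompInt m π (gn n) - Y) 2 P
      ≤ eLpNorm (simpleCompInt m π (gn n) - simpleCompInt m π (fn n)) 2 P
        + eLpNorm (simpleCompInt m π (fn n) - Y) 2 P := by
        rw [e1]
        exact eLpNorm_add_le (hmg.sub hmf) (hmf.sub h4.1.1) (by norm_num)
    _ = eLpNorm (⇑(gn n) - ⇑(fn n)) 2 m + eLpNorm (simpleCompInt m π (fn n) - Y) 2 P := by
        have hsub : MemLp (⇑(gn n - fn n)) 2 m := (hg n).sub (h2 n)
        rw [← eLpNorm_congr_ae (simpleCompInt_sub hπ (hg n) (h2 n)),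
          eLpNorm_two_simpleCompInt hπ hsub]
        rfl
    _ ≤ _ := by
        refine add_le_add ?_ le_rfl
        rw [e2]
        exact eLpNorm_sub_le ((hg n).1.sub h1.1) ((h2 n).1.sub h1.1) (by norm_num)

/-- `E |∫ f d(π - m)| ≤ 2 ∫ |f| dm` for every square integrable `f`. -/
theorem IsCompensatedIntegral.eLpNorm_one_le (hπ : IsPoissonRandomMeasure m π P)
    {f : E → F} {Y : Ω → F} (h : IsCompensatedIntegral m π P f Y) :
    eLpNorm Y 1 P ≤ 2 * eLpNorm f 1 m := by
  by_cases hfin : eLpNorm f 1 m = ∞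
  · simp [hfin]
  borelize F
  -- A strongly measurable version of `f` is approximated simultaneously in `L¹` and in `L²`.
  obtain ⟨f', hf', hff'⟩ := h.1.1
  have h' := h.congr hff' (ae_eq_refl Y)
  rw [eLpNorm_congr_ae hff'] at hfin ⊢
  have := hf'.separableSpace_range_union_singleton (b := 0)
  set gn := fun n => SimpleFunc.approxOn f' hf'.measurable (range f' ∪ {0}) 0 (by simp) n with hgn
  have ht2 := SimpleFunc.tendsto_approxOn_range_Lp_eLpNorm (p := 2) (by norm_num)
    hf'.measurable h'.1.2
  have ht1 := SimpleFunc.tendsto_approxOn_range_Lp_eLpNorm (p := 1) (by norm_num)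
    hf'.measurable (lt_top_iff_ne_top.2 hfin)
  have hg2 : ∀ n, MemLp (gn n) 2 m := fun n =>
    SimpleFunc.memLp_approxOn_range hf'.measurable h'.1 n
  have hL := h'.isL2Limit hπ hg2 ht2
  have hk : Tendsto (fun n => 2 * (eLpNorm (⇑(gn n) - f') 1 m + eLpNorm f' 1 m)) atTop
      (𝓝 (2 * eLpNorm f' 1 m)) := by
    have := ENNReal.Tendsto.const_mul (ht1.add_const (eLpNorm f' 1 m))
      (a := 2) (Or.inr (by norm_num))
    rwa [zero_add] at this
  refine hL.eLpNorm_one_le (fun n => (memLp_simpleCompInt hπ (hg2 n)).1) hk fun n => ?_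
  refine (eLpNorm_one_simpleCompInt_le hπ (hg2 n)).trans ?_
  gcongr
  have e : (gn n : E → F) = (⇑(gn n) - f') + f' := by abel
  calc eLpNorm (gn n) 1 m = eLpNorm ((⇑(gn n) - f') + f') 1 m := by rw [← e]
    _ ≤ _ := eLpNorm_add_le ((hg2 n).1.sub h'.1.1) h'.1.1 le_rfl

end Inner

end CompensatedIntegral

/-! ### The rational approximation of the exponential -/

theorem pow_mul_exp_neg_half_le (k : ℕ) {y : ℝ} (hy : 0 ≤ y) :
    y ^ k * Real.exp (-(y / 2)) ≤ 2 ^ k * k.factorial := by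
  have h := Real.pow_div_factorial_le_exp (y / 2) (by positivity) k
  rw [div_le_iff₀ (by positivity), div_pow, div_le_iff₀ (by positivity)] at h
  rw [Real.exp_neg, ← div_eq_mul_inv, div_le_iff₀ (Real.exp_pos _)]
  linarith

/-- The stability function `x ↦ (1 - (1 - θ) x) / (1 + θ x)` of the `θ`-scheme. -/
noncomputable def stabFn (θ x : ℝ) : ℝ := (1 - (1 - θ) * x) / (1 + θ * x)

/-- The scalar error of one noise contribution: `n` steps of the scheme and one resolvent, compared
with the exponential at a time `τ` measured in time steps. -/
noncomputable def stepErr (θ : ℝ) (n : ℕ) (τ x : ℝ) : ℝ :=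
  Real.exp (-(τ * x)) - stabFn θ x ^ n / (1 + θ * x)

section Scalar

variable {θ x : ℝ}

theorem stabFn_nonneg (hθ : 0 < θ) (hx : 0 ≤ x) (hx1 : x ≤ 1) : 0 ≤ stabFn θ x := by
  unfold stabFn
  have : 0 ≤ 1 - (1 - θ) * x := by nlinarith
  positivity

theorem stabFn_eq (hθ : 0 < θ) (hx : 0 ≤ x) : stabFn θ x = 1 - x / (1 + θ * x) := by
  unfold stabFn
  have : 0 < 1 + θ * x := by positivity
  field_simp
  ring

theorem stabFn_le_exp (hθ : 0 < θ) (hθ1 : θ ≤ 1) (hx : 0 ≤ x) (hx1 : x ≤ 1) :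
    stabFn θ x ≤ Real.exp (-(x / 2)) := by
  rw [stabFn_eq hθ hx]
  have h1 : x / 2 ≤ x / (1 + θ * x) := by
    apply div_le_div_of_nonneg_left hx (by positivity)
    nlinarith
  have h2 := Real.add_one_le_exp (-(x / 2))
  linarith

theorem abs_stabFn_sub_exp_le (hθ : 0 < θ) (hθ1 : θ ≤ 1) (hx : 0 ≤ x) (hx1 : x ≤ 1) :
    |stabFn θ x - Real.exp (-x)| ≤ 2 * x ^ 2 := by
  have h1 := Real.abs_exp_sub_one_sub_id_le (x := -x) (by rw [abs_neg, abs_of_nonneg hx]; exact hx1)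
  have hpos : 0 < 1 + θ * x := by positivity
  have h2 : x - x / (1 + θ * x) = θ * x ^ 2 / (1 + θ * x) := by field_simp; ring
  have h3 : 0 ≤ θ * x ^ 2 / (1 + θ * x) := by positivity
  have h4 : θ * x ^ 2 / (1 + θ * x) ≤ x ^ 2 := by
    rw [div_le_iff₀ hpos]
    nlinarith [sq_nonneg x, mul_nonneg hθ.le hx, mul_nonneg (mul_nonneg hθ.le hx) (sq_nonneg x)]
  rw [stabFn_eq hθ hx]
  rw [abs_le] at h1 ⊢
  constructor <;> nlinarith

theorem abs_stabFn_pow_sub_exp_le (hθ : 0 < θ) (hθ1 : θ ≤ 1) (hx : 0 ≤ x) (hx1 : x ≤ 1)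
    {n : ℕ} (hn : 1 ≤ n) :
    |stabFn θ x ^ n - Real.exp (-(n * x))| ≤ 4 * n * x ^ 2 * Real.exp (-(n * x / 2)) := by
  obtain ⟨n, rfl⟩ := Nat.exists_eq_add_of_le' hn
  have hM : Real.exp (-x) ≤ Real.exp (-(x / 2)) := Real.exp_le_exp.2 (by linarith)
  have hr0 := stabFn_nonneg hθ hx hx1
  have hM : max |stabFn θ x| |Real.exp (-x)| ≤ Real.exp (-(x / 2)) := by
    rw [abs_of_nonneg hr0, abs_of_pos (Real.exp_pos _)]
    exact max_le (stabFn_le_exp hθ hθ1 hx hx1) (Real.exp_le_exp.2 (by linarith))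
  have h := abs_pow_sub_pow_le (n := n + 1) (stabFn θ x) (Real.exp (-x))
  replace h := h.trans (mul_le_mul_of_nonneg_left (pow_le_pow_left₀ (by positivity) hM _)
    (by positivity))
  rw [Nat.add_sub_cancel] at h
  rw [← Real.exp_nat_mul, ← Real.exp_nat_mul] at h
  have e1 : ((n + 1 : ℕ) : ℝ) * -x = -((n + 1 : ℕ) * x) := by ring
  rw [e1] at h
  have e2 : Real.exp (n * -(x / 2)) ≤ 2 * Real.exp (-((n + 1 : ℕ) * x / 2)) := by
    have : Real.exp (n * -(x / 2)) = Real.exp (x / 2) * Real.exp (-((n + 1 : ℕ) * x / 2)) := by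
      rw [← Real.exp_add]; congr 1; push_cast; ring
    rw [this]
    gcongr
    have h1 : Real.exp (x / 2) ≤ Real.exp (1 / 2) := Real.exp_le_exp.2 (by linarith)
    have h2 : Real.exp (1 / 2) ^ 2 ≤ 4 := by
      rw [← Real.exp_nat_mul]
      have := Real.exp_one_lt_d9
      norm_num
      linarith
    nlinarith [Real.exp_pos (1 / 2 : ℝ)]
  refine h.trans ?_
  calc |stabFn θ x - Real.exp (-x)| * ((n + 1 : ℕ) : ℝ) * Real.exp (n * -(x / 2))
      ≤ (2 * x ^ 2) * ((n + 1 : ℕ) : ℝ) * (2 * Real.exp (-((n + 1 : ℕ) * x / 2))) := by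
        gcongr
        exact abs_stabFn_sub_exp_le hθ hθ1 hx hx1
    _ = _ := by push_cast; ring

/-- For `x ≥ 1` the modulus of the stability function is bounded by the larger one of its values at
`x = 1` and `x = ∞`. -/
theorem abs_stabFn_le (hθ : 0 < θ) (hx : 1 ≤ x) :
    |stabFn θ x| ≤ max (θ / (1 + θ)) ((1 - θ) / θ) := by
  have hpos : 0 < 1 + θ * x := by positivity
  unfold stabFn
  rw [abs_le']
  constructor
  · refine le_max_of_le_left ?_
    rw [div_le_div_iff₀ hpos (by positivity)]
    nlinarith
  · refine le_max_of_le_right ?_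
    rw [← neg_div, div_le_div_iff₀ hpos hθ]
    nlinarith

theorem exists_bound_sq_mul_pow {ρ : ℝ} (h0 : 0 ≤ ρ) (h1 : ρ < 1) :
    ∃ B : ℝ, 0 ≤ B ∧ ∀ n : ℕ, 1 ≤ n → (n + 2 : ℝ) ^ 2 * ρ ^ n ≤ B := by
  obtain ⟨b, hb⟩ := (tendsto_pow_const_mul_const_pow_of_abs_lt_one 2
    (by rwa [abs_of_nonneg h0])).bddAbove_range
  have hb' : ∀ n : ℕ, (n : ℝ) ^ 2 * ρ ^ n ≤ b := fun n => hb ⟨n, rfl⟩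
  refine ⟨9 * b, ?_, fun n hn => ?_⟩
  · have := hb' 0
    norm_num at this
    linarith
  · have hn' : (1 : ℝ) ≤ n := by exact_mod_cast hn
    have h := hb' n
    have hp : 0 ≤ ρ ^ n := pow_nonneg h0 n
    have : (n + 2 : ℝ) ^ 2 ≤ 9 * (n : ℝ) ^ 2 := by nlinarith
    nlinarith

/-- The condition `θ > 1/2` is what keeps the limit of the stability function at `∞` away from
`-1`. -/
theorem max_stabFn_limit_lt_one (hθ : θ ∈ Ioc (1 / 2 : ℝ) 1) : max (θ / (1 + θ)) ((1 - θ) / θ) < 1 := by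
  have h : 0 < θ := by linarith [hθ.1]
  refine max_lt ?_ ?_
  · rw [div_lt_one (by positivity)]; linarith
  · rw [div_lt_one h]; linarith [hθ.1]

/-- The scheme is of order one for nonsmooth initial values, uniformly in the eigenvalue. -/
theorem exists_stabFn_pow_bound (hθ : θ ∈ Ioc (1 / 2 : ℝ) 1) :
    ∃ C : ℝ, 0 < C ∧ ∀ (n : ℕ) (x : ℝ), 1 ≤ n → 0 ≤ x →
      n * |Real.exp (-(n * x)) - stabFn θ x ^ n| ≤ C := by
  have hθ0 : 0 < θ := by linarith [hθ.1]
  set ρ := max (θ / (1 + θ)) ((1 - θ) / θ) with hρ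
  have hρ0 : 0 ≤ ρ := le_max_of_le_left (by positivity)
  obtain ⟨B, hB0, hB⟩ := exists_bound_sq_mul_pow hρ0 (max_stabFn_limit_lt_one hθ)
  refine ⟨33 + B, by positivity, fun n x hn hx => ?_⟩
  have hn' : (1 : ℝ) ≤ n := by exact_mod_cast hn
  rcases le_total x 1 with hx1 | hx1
  · have h := abs_stabFn_pow_sub_exp_le hθ0 hθ.2 hx hx1 hn
    rw [abs_sub_comm] at h
    have h2 := pow_mul_exp_neg_half_le 2 (y := n * x) (by positivity)
    norm_num at h2
    calc _ ≤ n * (4 * n * x ^ 2 * Real.exp (-(n * x / 2))) := by gcongr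
      _ = 4 * ((n * x) ^ 2 * Real.exp (-(n * x / 2))) := by ring
      _ ≤ 33 + B := by linarith
  · have h1 : |stabFn θ x ^ n| ≤ ρ ^ n := by
      rw [abs_pow]
      exact pow_le_pow_left₀ (abs_nonneg _) (abs_stabFn_le hθ0 hx1) n
    have h2 : Real.exp (-(n * x)) ≤ Real.exp (-n) := Real.exp_le_exp.2 (by nlinarith)
    have h3 : n * Real.exp (-(n : ℝ)) ≤ 1 := by
      rw [Real.exp_neg, ← div_eq_mul_inv, div_le_one (Real.exp_pos _)]
      linarith [Real.add_one_le_exp (n : ℝ)]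
    have h4 : n * ρ ^ n ≤ B := by
      refine le_trans ?_ (hB n hn)
      gcongr
      nlinarith
    have h5 : |Real.exp (-(n * x)) - stabFn θ x ^ n| ≤ Real.exp (-n) + ρ ^ n := by
      refine (abs_sub _ _).trans ?_
      rw [abs_of_pos (Real.exp_pos _)]
      exact add_le_add h2 h1
    calc _ ≤ n * (Real.exp (-n) + ρ ^ n) := by gcongr
      _ ≤ 33 + B := by linarith

/-- The factor `1 + τ` expresses the order one of the scheme, the factor `1 + τ x` its smoothing
property. -/
theorem exists_stepErr_bound (hθ : θ ∈ Ioc (1 / 2 : ℝ) 1) :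
    ∃ C : ℝ, 0 < C ∧ ∀ (n : ℕ) (τ x : ℝ), (n : ℝ) ≤ τ → τ ≤ n + 1 → 0 ≤ x →
      (1 + τ) * (1 + τ * x) * |stepErr θ n τ x| ≤ C := by
  have hθ0 : 0 < θ := by linarith [hθ.1]
  set ρ := max (θ / (1 + θ)) ((1 - θ) / θ) with hρ
  have hρ0 : 0 ≤ ρ := le_max_of_le_left (by positivity)
  obtain ⟨B, hB0, hB⟩ := exists_bound_sq_mul_pow hρ0 (max_stabFn_limit_lt_one hθ)
  refine ⟨2 * (1 + 1 / θ) + 3 * (4 + 64 + 384) + (4 + B / θ), by positivity,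
    fun n τ x hnτ hτn hx => ?_⟩
  have hpos : 0 < 1 + θ * x := by positivity
  have hτ0 : 0 ≤ τ := (Nat.cast_nonneg n).trans hnτ
  have hinv : ∀ u : ℝ, 0 ≤ u → (1 + u * x) / (1 + θ * x) ≤ (1 + u) / θ := by
    intro u hu
    rw [div_le_div_iff₀ hpos hθ0]
    nlinarith [mul_nonneg hu hx, hθ.2, mul_nonneg hθ0.le hx]
  rcases Nat.eq_zero_or_pos n with rfl | hn
  · -- before the first full step: both terms are separately of the right size
    simp only [Nat.cast_zero, zero_add] at hτn
    have h1 : (1 + τ * x) * Real.exp (-(τ * x)) ≤ 1 := by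
      rw [Real.exp_neg, ← div_eq_mul_inv, div_le_one (Real.exp_pos _)]
      linarith [Real.add_one_le_exp (τ * x)]
    have h2 : (1 + τ * x) * (1 / (1 + θ * x)) ≤ 1 / θ := by
      rw [mul_one_div, div_le_div_iff₀ hpos hθ0]
      nlinarith [mul_nonneg hτ0 hx, hθ.2, mul_nonneg hθ0.le hx]
    have h3 : |stepErr θ 0 τ x| ≤ Real.exp (-(τ * x)) + 1 / (1 + θ * x) := by
      unfold stepErr
      rw [pow_zero]
      refine (abs_sub _ _).trans ?_
      rw [abs_of_pos (Real.exp_pos _), abs_of_pos (by positivity)]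
    have h4 : (1 + τ * x) * |stepErr θ 0 τ x| ≤ 1 + 1 / θ := by
      calc _ ≤ (1 + τ * x) * (Real.exp (-(τ * x)) + 1 / (1 + θ * x)) := by gcongr
        _ ≤ _ := by rw [mul_add]; exact add_le_add h1 h2
    calc (1 + τ) * (1 + τ * x) * |stepErr θ 0 τ x| = (1 + τ) * ((1 + τ * x) * |stepErr θ 0 τ x|) := by
          ring
      _ ≤ 2 * (1 + 1 / θ) := by
          gcongr
          linarith
      _ ≤ _ := by
          have : 0 ≤ B / θ := by positivity
          linarith
  · have hn' : (1 : ℝ) ≤ n := by exact_mod_cast hn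
    rcases le_total x 1 with hx1 | hx1
    · -- small `x`: consistency of second order
      have hy : 0 ≤ (n : ℝ) * x := by positivity
      set E := Real.exp (-(n * x / 2)) with hE
      have hE0 : 0 < E := Real.exp_pos _
      have h1 := abs_stabFn_pow_sub_exp_le hθ0 hθ.2 hx hx1 hn
      have hr0 := stabFn_nonneg hθ0 hx hx1
      have hr : stabFn θ x ^ n ≤ E := by
        refine (pow_le_pow_left₀ hr0 (stabFn_le_exp hθ0 hθ.2 hx hx1) n).trans ?_
        rw [← Real.exp_nat_mul, hE]
        exact Real.exp_le_exp.2 (by linarith)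
      have h2 : |stabFn θ x ^ n - stabFn θ x ^ n / (1 + θ * x)| ≤ x * E := by
        have e : stabFn θ x ^ n - stabFn θ x ^ n / (1 + θ * x)
            = stabFn θ x ^ n * (θ * x / (1 + θ * x)) := by field_simp; ring
        have e2 : θ * x / (1 + θ * x) ≤ x := by
          rw [div_le_iff₀ hpos]
          nlinarith [mul_nonneg hθ0.le hx, hθ.2, mul_nonneg (mul_nonneg hθ0.le hx) hx]
        rw [e, abs_of_nonneg (by positivity)]
        calc _ ≤ E * x := by gcongr
          _ = x * E := mul_comm _ _
      have h3 : |Real.exp (-(τ * x)) - Real.exp (-(n * x))| ≤ x * E := by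
        have hle : Real.exp (-(τ * x)) ≤ Real.exp (-(n * x)) := Real.exp_le_exp.2 (by nlinarith)
        rw [abs_sub_comm, abs_of_nonneg (by linarith)]
        have e : Real.exp (-(τ * x)) = Real.exp (-(n * x)) * Real.exp (-((τ - n) * x)) := by
          rw [← Real.exp_add]; congr 1; ring
        have e1 := Real.add_one_le_exp (-((τ - n) * x))
        have e2 : Real.exp (-(n * x)) ≤ E := Real.exp_le_exp.2 (by linarith)
        have e3 : (τ - n) * x ≤ x := by nlinarith
        have e4 : 1 - Real.exp (-((τ - n) * x)) ≤ x := by linarith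
        rw [e]
        calc _ = Real.exp (-(n * x)) * (1 - Real.exp (-((τ - n) * x))) := by ring
          _ ≤ Real.exp (-(n * x)) * x := by gcongr
          _ ≤ E * x := by gcongr
          _ = x * E := mul_comm _ _
      have hF : |stepErr θ n τ x| ≤ (4 * n * x ^ 2 + 2 * x) * E := by
        have e : stepErr θ n τ x = (Real.exp (-(τ * x)) - Real.exp (-(n * x)))
            - (stabFn θ x ^ n - Real.exp (-(n * x)))
            + (stabFn θ x ^ n - stabFn θ x ^ n / (1 + θ * x)) := by
          unfold stepErr; ring
        rw [e]
        refine (abs_add_le _ _).trans ?_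
        have := abs_sub (Real.exp (-(τ * x)) - Real.exp (-(n * x)))
          (stabFn θ x ^ n - Real.exp (-(n * x)))
        linarith
      have k1 := pow_mul_exp_neg_half_le 1 hy
      have k2 := pow_mul_exp_neg_half_le 2 hy
      have k3 := pow_mul_exp_neg_half_le 3 hy
      simp only [Nat.factorial, pow_one] at k1 k2 k3
      norm_num at k1 k2 k3
      rw [← hE] at k1 k2 k3
      calc (1 + τ) * (1 + τ * x) * |stepErr θ n τ x|
          ≤ (3 * n) * (1 + 2 * n * x) * ((4 * n * x ^ 2 + 2 * x) * E) := by
            gcongr <;> linarith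
        _ = 3 * (2 * (n * x * E) + 8 * ((n * x) ^ 2 * E) + 8 * ((n * x) ^ 3 * E)) := by ring
        _ ≤ 3 * (2 * 2 + 8 * 8 + 8 * 48) := by gcongr
        _ ≤ _ := by
          have : 0 ≤ B / θ := by positivity
          have : 0 ≤ 1 / θ := by positivity
          linarith
    · -- large `x`: both terms decay geometrically in `n`
      have h1 : |stabFn θ x ^ n| ≤ ρ ^ n := by
        rw [abs_pow]
        exact pow_le_pow_left₀ (abs_nonneg _) (abs_stabFn_le hθ0 hx1) n
      have h3 : |stepErr θ n τ x| ≤ Real.exp (-(τ * x)) + ρ ^ n / (1 + θ * x) := by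
        unfold stepErr
        refine (abs_sub _ _).trans ?_
        rw [abs_of_pos (Real.exp_pos _), abs_div, abs_of_pos hpos]
        gcongr
      have h4 : (1 + τ) * (1 + τ * x) * Real.exp (-(τ * x)) ≤ 4 := by
        have hz : 0 ≤ τ * x := by positivity
        have e1 : 1 + τ * x ≤ 2 * Real.exp (τ * x / 2) := by
          linarith [Real.add_one_le_exp (τ * x / 2)]
        have e2 : Real.exp (τ * x / 2) * Real.exp (τ * x / 2) = Real.exp (τ * x) := by
          rw [← Real.exp_add]; congr 1; ring
        rw [Real.exp_neg, ← div_eq_mul_inv, div_le_iff₀ (Real.exp_pos _)]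
        calc (1 + τ) * (1 + τ * x) ≤ (1 + τ * x) * (1 + τ * x) := by
              gcongr
              nlinarith
          _ ≤ (2 * Real.exp (τ * x / 2)) * (2 * Real.exp (τ * x / 2)) := by gcongr
          _ = 4 * Real.exp (τ * x) := by rw [← e2]; ring
      have h5 : (1 + τ) * (1 + τ * x) * (ρ ^ n / (1 + θ * x)) ≤ B / θ := by
        calc (1 + τ) * (1 + τ * x) * (ρ ^ n / (1 + θ * x))
            = (1 + τ) * ((1 + τ * x) / (1 + θ * x)) * ρ ^ n := by ring
          _ ≤ (1 + τ) * ((1 + τ) / θ) * ρ ^ n := by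
              refine mul_le_mul_of_nonneg_right ?_ (pow_nonneg hρ0 n)
              exact mul_le_mul_of_nonneg_left (hinv τ hτ0) (by positivity)
          _ = ((1 + τ) ^ 2 * ρ ^ n) / θ := by ring
          _ ≤ ((n + 2 : ℝ) ^ 2 * ρ ^ n) / θ := by
              have : 1 + τ ≤ n + 2 := by linarith
              gcongr
          _ ≤ B / θ := by
              gcongr
              exact hB n hn
      calc (1 + τ) * (1 + τ * x) * |stepErr θ n τ x|
          ≤ (1 + τ) * (1 + τ * x) * (Real.exp (-(τ * x)) + ρ ^ n / (1 + θ * x)) := by gcongr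
        _ ≤ 4 + B / θ := by rw [mul_add]; exact add_le_add h4 h5
        _ ≤ _ := by
          have : 0 ≤ 1 / θ := by positivity
          linarith

end Scalar

/-! ### Fractional powers and Hilbert–Schmidt sums in an eigenbasis -/

section Hilbert

variable {H : Type*} [NormedAddCommGroup H] [InnerProductSpace ℝ H] [CompleteSpace H]
  {e : HilbertBasis ℕ ℝ H} {lam : ℕ → ℝ}

theorem IsEigenbasis.pos {A : H →ₗ.[ℝ] H} (hA : IsStrictlyPositiveCompact A)
    (he : IsEigenbasis A lam e) (k : ℕ) : 0 < lam k := by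
  obtain ⟨hk, h⟩ := he.eigen k
  have hne : e k ≠ 0 := e.orthonormal.ne_zero k
  have := hA.pos ⟨e k, hk⟩ (by simpa [Subtype.ext_iff] using hne)
  rw [h, real_inner_smul_left, real_inner_self_eq_norm_sq, e.orthonormal.norm_eq_one] at this
  simpa using this

theorem sum_sq_inner_le (v : H) (J : Finset ℕ) :
    ∑ j ∈ J, inner ℝ (e j) v ^ 2 ≤ ‖v‖ ^ 2 := by
  simpa using e.orthonormal.sum_inner_products_le (x := v) (s := J)

theorem inner_powOp (s : ℝ) (y : (powOp e lam s).domain) (j : ℕ) :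
    inner ℝ (e j) (powOp e lam s y) = lam j ^ s * inner ℝ (e j) (y : H) := by
  rw [← e.repr_apply_apply, ← e.repr_apply_apply]
  change e.repr (e.repr.symm ⟨fun k => lam k ^ s * e.repr (y : H) k, y.2⟩) j = _
  rw [LinearIsometryEquiv.apply_symm_apply]

theorem sum_mul_sq_inner_le_powOp (hlam : ∀ k, 0 < lam k) (y : (powOp e lam (1 / 2)).domain)
    (J : Finset ℕ) :
    ∑ j ∈ J, lam j * inner ℝ (e j) (y : H) ^ 2 ≤ ‖powOp e lam (1 / 2) y‖ ^ 2 := by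
  refine le_trans (le_of_eq ?_) (sum_sq_inner_le (e := e) (powOp e lam (1 / 2) y) J)
  refine Finset.sum_congr rfl fun j _ => ?_
  rw [inner_powOp, mul_pow, ← Real.sqrt_eq_rpow, Real.sq_sqrt (hlam j).le]

/-- Interpolation between the norms of `H` and of `D(A^{1/2})`, on the level of coefficients. -/
theorem sum_rpow_mul_sq_le {p a b r : ℝ} (hlam : ∀ k, 0 < lam k) (hp0 : 0 ≤ p) (hp1 : p ≤ 1)
    (ha : 0 ≤ a) (hb : 0 ≤ b) (hr : 0 ≤ r) (J : Finset ℕ) (c : ℕ → ℝ)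
    (h0 : ∑ j ∈ J, c j ^ 2 ≤ (a * r) ^ 2) (h1 : ∑ j ∈ J, lam j * c j ^ 2 ≤ (b * r) ^ 2) :
    ∑ j ∈ J, lam j ^ p * c j ^ 2 ≤ (b ^ p * a ^ (1 - p) * r) ^ 2 := by
  rcases hp0.eq_or_lt with rfl | hp
  · simpa using h0
  have hw := Real.inner_le_weight_mul_Lp_of_nonneg J (p := p⁻¹) ((one_le_inv₀ hp).2 hp1)
    (fun j => c j ^ 2) (fun j => lam j ^ p) (fun j => sq_nonneg _)
    (fun j => (Real.rpow_pos_of_pos (hlam j) _).le)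
  rw [inv_inv] at hw
  have e1 : ∀ j, (lam j ^ p) ^ p⁻¹ = lam j := fun j => by
    rw [← Real.rpow_mul (hlam j).le, mul_inv_cancel₀ hp.ne', Real.rpow_one]
  simp only [e1] at hw
  have e2 : ∀ x : ℝ, 0 ≤ x → ∀ q : ℝ, (x ^ 2) ^ q = (x ^ q) ^ 2 := fun x hx q => by
    rw [← Real.rpow_natCast, ← Real.rpow_natCast, ← Real.rpow_mul hx, ← Real.rpow_mul hx, mul_comm]
  calc ∑ j ∈ J, lam j ^ p * c j ^ 2 = ∑ j ∈ J, c j ^ 2 * lam j ^ p := by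
        simp only [mul_comm]
    _ ≤ (∑ j ∈ J, c j ^ 2) ^ (1 - p) * (∑ j ∈ J, c j ^ 2 * lam j) ^ p := hw
    _ ≤ ((a * r) ^ 2) ^ (1 - p) * ((b * r) ^ 2) ^ p := by
        have h1' : ∑ j ∈ J, c j ^ 2 * lam j ≤ (b * r) ^ 2 := by simpa only [mul_comm] using h1
        have n0 : 0 ≤ ∑ j ∈ J, c j ^ 2 := Finset.sum_nonneg fun j _ => sq_nonneg _
        have n1 : 0 ≤ ∑ j ∈ J, c j ^ 2 * lam j :=
          Finset.sum_nonneg fun j _ => mul_nonneg (sq_nonneg _) (hlam j).le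
        have : 0 ≤ 1 - p := by linarith
        gcongr
    _ = (b ^ p * a ^ (1 - p) * r) ^ 2 := by
        rw [e2 _ (by positivity), e2 _ (by positivity), ← mul_pow, Real.mul_rpow ha hr,
          Real.mul_rpow hb hr]
        congr 1
        have : r ^ (1 - p) * r ^ p = r := by
          rw [← Real.rpow_add' hr (by norm_num)]
          simp
        calc a ^ (1 - p) * r ^ (1 - p) * (b ^ p * r ^ p)
            = b ^ p * a ^ (1 - p) * (r ^ (1 - p) * r ^ p) := by ring
          _ = _ := by rw [this]

/-- The estimate `‖G R‖_HS ≤ ‖A^{p/2} G‖ ‖A^{-p/2} R‖_HS` for symmetric `G` and `R`. The weight is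
moved from one factor to the other by the Cauchy–Schwarz inequality. -/
theorem sum_norm_sq_comp_le {p K D : ℝ} (hlam : ∀ k, 0 < lam k) {G : H → H}
    (hG : ∀ x y, inner ℝ (G x) y = inner ℝ x (G y))
    (hK : ∀ (x : H) (J : Finset ℕ),
      ∑ j ∈ J, lam j ^ p * inner ℝ (e j) (G x) ^ 2 ≤ (K * ‖x‖) ^ 2)
    {R : H →L[ℝ] H} (hR : ∀ x y, inner ℝ (R x) y = inner ℝ x (R y))
    (hD : ∀ J : Finset ℕ, ∑ j ∈ J, lam j ^ (-p) * ‖R (e j)‖ ^ 2 ≤ D)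
    (b : HilbertBasis ℕ ℝ H) (I : Finset ℕ) :
    ∑ k ∈ I, ‖G (R (b k))‖ ^ 2 ≤ K ^ 2 * D := by
  have hD0 : 0 ≤ D := by simpa using hD ∅
  set u : ℕ → H := fun k => G (R (b k)) with hu
  set U := ∑ k ∈ I, ‖u k‖ ^ 2 with hU
  have hU0 : 0 ≤ U := Finset.sum_nonneg fun k _ => sq_nonneg _
  have hsum : HasSum (fun j => ∑ k ∈ I, inner ℝ (R (b k)) (e j) * inner ℝ (e j) (G (u k))) U := by
    refine hasSum_sum fun k _ => ?_
    have := e.hasSum_inner_mul_inner (R (b k)) (G (u k))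
    rw [← hG, real_inner_self_eq_norm_sq] at this
    exact this
  have hpart : ∀ J : Finset ℕ,
      (∑ j ∈ J, ∑ k ∈ I, inner ℝ (R (b k)) (e j) * inner ℝ (e j) (G (u k))) ^ 2
        ≤ D * (K ^ 2 * U) := by
    intro J
    rw [← Finset.sum_product']
    have hw : ∀ j, 0 < lam j ^ (p / 2) := fun j => Real.rpow_pos_of_pos (hlam j) _
    have hsq : ∀ j, (lam j ^ (p / 2)) ^ 2 = lam j ^ p := fun j => by
      rw [← Real.rpow_natCast, ← Real.rpow_mul (hlam j).le]; congr 1; push_cast; ring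
    have e1 : ∀ x ∈ J ×ˢ I, inner ℝ (R (b x.2)) (e x.1) * inner ℝ (e x.1) (G (u x.2))
        = ((lam x.1 ^ (p / 2))⁻¹ * inner ℝ (R (b x.2)) (e x.1))
          * (lam x.1 ^ (p / 2) * inner ℝ (e x.1) (G (u x.2))) := by
      intro x _
      have := (hw x.1).ne'
      field_simp
    rw [Finset.sum_congr rfl e1]
    refine (Finset.sum_mul_sq_le_sq_mul_sq _ _ _).trans ?_
    refine mul_le_mul ?_ ?_ (Finset.sum_nonneg fun _ _ => sq_nonneg _) hD0
    · rw [Finset.sum_product]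
      refine le_trans (Finset.sum_le_sum fun j _ => ?_) (hD J)
      calc ∑ k ∈ I, ((lam j ^ (p / 2))⁻¹ * inner ℝ (R (b k)) (e j)) ^ 2
          = lam j ^ (-p) * ∑ k ∈ I, inner ℝ (b k) (R (e j)) ^ 2 := by
            rw [Finset.mul_sum]
            refine Finset.sum_congr rfl fun k _ => ?_
            rw [mul_pow, inv_pow, hsq, hR, Real.rpow_neg (hlam j).le]
        _ ≤ lam j ^ (-p) * ‖R (e j)‖ ^ 2 := by
            refine mul_le_mul_of_nonneg_left (sum_sq_inner_le _ _) ?_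
            exact (Real.rpow_pos_of_pos (hlam j) _).le
    · rw [Finset.sum_product_right, hU, Finset.mul_sum]
      refine Finset.sum_le_sum fun k _ => ?_
      calc ∑ j ∈ J, (lam j ^ (p / 2) * inner ℝ (e j) (G (u k))) ^ 2
          = ∑ j ∈ J, lam j ^ p * inner ℝ (e j) (G (u k)) ^ 2 := by
            refine Finset.sum_congr rfl fun j _ => ?_
            rw [mul_pow, hsq]
        _ ≤ K ^ 2 * ‖u k‖ ^ 2 := by rw [← mul_pow]; exact hK _ _
  have hlim : U ^ 2 ≤ D * (K ^ 2 * U) := by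
    have ht : Tendsto (fun J : Finset ℕ =>
        (∑ j ∈ J, ∑ k ∈ I, inner ℝ (R (b k)) (e j) * inner ℝ (e j) (G (u k))) ^ 2) atTop
        (𝓝 (U ^ 2)) := (show Tendsto _ _ _ from hsum).pow 2
    exact le_of_tendsto' ht hpart
  rcases hU0.eq_or_lt with h | h
  · rw [← h]; positivity
  · nlinarith

/-- The trace condition: `A^{-(α-β)/2} R` is a Hilbert–Schmidt operator. -/
theorem exists_sum_norm_sq_sqrt_le {α β : ℝ} (hlam : ∀ k, 0 < lam k)
    (hTr : Summable (fun k => lam k ^ (-α))) {Q R : H →L[ℝ] H}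
    (hR : ∀ x y, inner ℝ (R x) y = inner ℝ x (R y))
    (hRQ : R ∘L R = Q) (hAQ : IsBoundedComp (powOp e lam β) Q) :
    ∃ D : ℝ, 0 ≤ D ∧ ∀ J : Finset ℕ, ∑ j ∈ J, lam j ^ (-(α - β)) * ‖R (e j)‖ ^ 2 ≤ D := by
  obtain ⟨hL, c, hc⟩ := hAQ
  have hc' : ∀ x, ‖powOp e lam β ⟨Q x, hL x⟩‖ ≤ |c| * ‖x‖ := fun x =>
    (hc x).trans (mul_le_mul_of_nonneg_right (le_abs_self c) (norm_nonneg _))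
  refine ⟨|c| * ∑' k, lam k ^ (-α), mul_nonneg (abs_nonneg _)
    (tsum_nonneg fun k => (Real.rpow_pos_of_pos (hlam k) _).le), fun J => ?_⟩
  have hj : ∀ j, ‖R (e j)‖ ^ 2 ≤ |c| * lam j ^ (-β) := by
    intro j
    have hl : 0 < lam j ^ β := Real.rpow_pos_of_pos (hlam j) _
    have h1 : ‖R (e j)‖ ^ 2 = inner ℝ (e j) (Q (e j)) := by
      rw [← real_inner_self_eq_norm_sq, hR, ← hRQ]; rfl
    have h3 : inner ℝ (e j) (powOp e lam β ⟨Q (e j), hL (e j)⟩)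
        = lam j ^ β * inner ℝ (e j) (Q (e j)) := inner_powOp β _ j
    have h4 : inner ℝ (e j) (powOp e lam β ⟨Q (e j), hL (e j)⟩) ≤ |c| := by
      refine (real_inner_le_norm _ _).trans ?_
      have := hc' (e j)
      rw [e.orthonormal.norm_eq_one] at this ⊢
      linarith
    rw [h1, Real.rpow_neg (hlam j).le, ← div_eq_mul_inv, le_div_iff₀ hl]
    linarith
  calc ∑ j ∈ J, lam j ^ (-(α - β)) * ‖R (e j)‖ ^ 2
      ≤ ∑ j ∈ J, |c| * lam j ^ (-α) := by
        refine Finset.sum_le_sum fun j _ => ?_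
        have hl : 0 ≤ lam j ^ (-(α - β)) := (Real.rpow_pos_of_pos (hlam j) _).le
        refine (mul_le_mul_of_nonneg_left (hj j) hl).trans (le_of_eq ?_)
        rw [mul_left_comm, ← Real.rpow_add (hlam j)]
        congr 2
        ring
    _ = |c| * ∑ j ∈ J, lam j ^ (-α) := by rw [Finset.mul_sum]
    _ ≤ _ := by
        refine mul_le_mul_of_nonneg_left ?_ (abs_nonneg _)
        exact hTr.sum_le_tsum _ fun k _ => (Real.rpow_pos_of_pos (hlam k) _).le

/-! ### The exact and the discrete semigroup -/

theorem inner_semigroup (hlam : ∀ k, 0 < lam k) {t : ℝ} (ht : 0 ≤ t) (u : H) (k : ℕ) :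
    inner ℝ (e k) (semigroup e lam t u) = Real.exp (-(t * lam k)) * inner ℝ (e k) u := by
  have hmem : Memℓp (fun k => Real.exp (-(t * lam k)) * inner ℝ (e k) u) 2 := by
    refine Memℓp.mono' (lp.memℓp (e.repr u)) fun k => ?_
    rw [e.repr_apply_apply, norm_mul]
    refine mul_le_of_le_one_left (norm_nonneg _) ?_
    rw [Real.norm_of_nonneg (Real.exp_pos _).le, Real.exp_le_one_iff]
    have := mul_nonneg ht (hlam k).le
    linarith
  have h := e.hasSum_repr_symm ⟨_, hmem⟩
  have h2 : semigroup e lam t u = e.repr.symm ⟨_, hmem⟩ := h.tsum_eq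
  rw [h2, ← e.repr_apply_apply, LinearIsometryEquiv.apply_symm_apply]

theorem inner_semigroup_comm (hlam : ∀ k, 0 < lam k) {t : ℝ} (ht : 0 ≤ t) (u v : H) :
    inner ℝ (semigroup e lam t u) v = inner ℝ u (semigroup e lam t v) := by
  rw [← e.tsum_inner_mul_inner, ← e.tsum_inner_mul_inner]
  refine tsum_congr fun k => ?_
  rw [inner_semigroup hlam ht, real_inner_comm, inner_semigroup hlam ht, real_inner_comm u]
  ring

theorem inner_coe_proj_comm (W : Submodule ℝ H) [FiniteDimensional ℝ W] {B : W →L[ℝ] W}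
    (hB : ∀ u v, inner ℝ (B u) v = inner ℝ u (B v)) (x y : H) :
    inner ℝ (B (proj W x) : H) y = inner ℝ x (B (proj W y) : H) := by
  have h1 : inner ℝ (B (proj W x) : H) y = inner ℝ (B (proj W x)) (proj W y) :=
    (W.inner_orthogonalProjectionOnto_eq_of_mem_left _ _).symm
  have h2 : inner ℝ x (B (proj W y) : H) = inner ℝ (proj W x) (B (proj W y)) :=
    (W.inner_orthogonalProjectionOnto_eq_of_mem_right _ _).symm
  rw [h1, h2, hB]

theorem norm_proj_le (W : Submodule ℝ H) [FiniteDimensional ℝ W] (x : H) :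
    ‖proj W x‖ ≤ ‖x‖ := by
  have := W.orthogonalProjectionOnto.le_opNorm x
  refine this.trans (mul_le_of_le_one_left (norm_nonneg _) W.orthogonalProjectionOnto_norm_le)

section Discrete

variable (W : Submodule ℝ H) [FiniteDimensional ℝ W] (hW : W ≤ (powOp e lam (1 / 2)).domain)

theorem discreteOp_symm (u v : W) :
    inner ℝ (discreteOp e lam W hW u) v = inner ℝ u (discreteOp e lam W hW v) := by
  rw [inner_discreteOp, real_inner_comm _ u, inner_discreteOp, real_inner_comm]

theorem discreteOp_isSymmetric :
    ((discreteOp e lam W hW : W →L[ℝ] W) : W →ₗ[ℝ] W).IsSymmetric :=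
  fun u v => discreteOp_symm W hW u v

/-- An orthonormal basis of `W` of eigenvectors of `A_h`. -/
noncomputable def discreteBasis : OrthonormalBasis (Fin (Module.finrank ℝ W)) ℝ W :=
  (discreteOp_isSymmetric (e := e) (lam := lam) W hW).eigenvectorBasis rfl

/-- The eigenvalues of `A_h`. -/
noncomputable def discreteEig (i : Fin (Module.finrank ℝ W)) : ℝ :=
  (discreteOp_isSymmetric (e := e) (lam := lam) W hW).eigenvalues rfl i

theorem discreteOp_basis (i) :
    discreteOp e lam W hW (discreteBasis W hW i) = discreteEig W hW i • discreteBasis W hW i :=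
  (discreteOp_isSymmetric (e := e) (lam := lam) W hW).apply_eigenvectorBasis rfl i

theorem discreteEig_nonneg (i) : 0 ≤ discreteEig W hW i := by
  have h := inner_discreteOp e lam W hW (discreteBasis W hW i) (discreteBasis W hW i)
  rw [discreteOp_basis, real_inner_smul_left, real_inner_self_eq_norm_sq,
    (discreteBasis W hW).norm_eq_one, real_inner_self_eq_norm_sq] at h
  have : 0 ≤ discreteEig W hW i * 1 ^ 2 := h ▸ sq_nonneg _
  simpa using this

/-- `B` is the function of `A_h` that takes the value `f i` at the `i`-th eigenvalue. -/
def IsDiscreteFun (f : Fin (Module.finrank ℝ W) → ℝ) (B : W →L[ℝ] W) : Prop :=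
  ∀ i, B (discreteBasis W hW i) = f i • discreteBasis W hW i

variable {W hW} {f g : Fin (Module.finrank ℝ W) → ℝ} {B B' : W →L[ℝ] W}

theorem IsDiscreteFun.mul (h : IsDiscreteFun W hW f B) (h' : IsDiscreteFun W hW g B') :
    IsDiscreteFun W hW (fun i => f i * g i) (B * B') := by
  intro i
  rw [mul_apply_eq_comp, h' i, map_smul, h i, smul_smul, mul_comm]

theorem IsDiscreteFun.sub (h : IsDiscreteFun W hW f B) (h' : IsDiscreteFun W hW g B') :
    IsDiscreteFun W hW (fun i => f i - g i) (B - B') := by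
  intro i
  rw [_root_.sub_apply, h i, h' i, sub_smul]

theorem IsDiscreteFun.one : IsDiscreteFun W hW (fun _ => 1) 1 := by
  intro i
  simp

theorem IsDiscreteFun.add (h : IsDiscreteFun W hW f B) (h' : IsDiscreteFun W hW g B') :
    IsDiscreteFun W hW (fun i => f i + g i) (B + B') := by
  intro i
  rw [_root_.add_apply, h i, h' i, add_smul]

theorem IsDiscreteFun.pow (h : IsDiscreteFun W hW f B) (n : ℕ) :
    IsDiscreteFun W hW (fun i => f i ^ n) (B ^ n) := by
  induction n with
  | zero => simpa using IsDiscreteFun.one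
  | succ n ih => simpa only [pow_succ] using ih.mul h

theorem IsDiscreteFun.smul_discreteOp (c : ℝ) :
    IsDiscreteFun W hW (fun i => c * discreteEig W hW i) (c • discreteOp e lam W hW) := by
  intro i
  rw [_root_.smul_apply, discreteOp_basis, smul_smul]

theorem IsDiscreteFun.inner_basis (h : IsDiscreteFun W hW f B) (v : W) (i) :
    inner ℝ (discreteBasis W hW i) (B v) = f i * inner ℝ (discreteBasis W hW i) v := by
  conv_lhs => rw [← (discreteBasis W hW).sum_repr' v, map_sum, inner_sum]
  rw [Finset.sum_eq_single i]
  · rw [map_smul, h i, smul_smul, real_inner_smul_right, real_inner_self_eq_norm_sq,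
      (discreteBasis W hW).norm_eq_one]
    ring
  · intro j _ hj
    rw [map_smul, h j, smul_smul, real_inner_smul_right,
      (discreteBasis W hW).orthonormal.2 hj.symm, mul_zero]
  · simp

theorem IsDiscreteFun.symm (h : IsDiscreteFun W hW f B) (u v : W) :
    inner ℝ (B u) v = inner ℝ u (B v) := by
  rw [← (discreteBasis W hW).sum_inner_mul_inner, ← (discreteBasis W hW).sum_inner_mul_inner]
  refine Finset.sum_congr rfl fun i _ => ?_
  rw [h.inner_basis, real_inner_comm, h.inner_basis, real_inner_comm u]
  ring

theorem IsDiscreteFun.norm_le (h : IsDiscreteFun W hW f B) {c : ℝ} (hc : 0 ≤ c)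
    (hf : ∀ i, |f i| ≤ c) (v : W) : ‖B v‖ ≤ c * ‖v‖ := by
  refine le_of_sq_le_sq ?_ (by positivity)
  rw [mul_pow, ← (discreteBasis W hW).sum_sq_norm_inner_right (B v),
    ← (discreteBasis W hW).sum_sq_norm_inner_right v, Finset.mul_sum]
  refine Finset.sum_le_sum fun i _ => ?_
  rw [h.inner_basis, norm_mul, mul_pow, Real.norm_eq_abs, sq_abs]
  exact mul_le_mul_of_nonneg_right (sq_le_sq' (abs_le.1 (hf i)).1 (abs_le.1 (hf i)).2)
    (sq_nonneg _)

theorem IsDiscreteFun.norm_sqrt_le (h : IsDiscreteFun W hW f B) {c : ℝ}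
    (hf : ∀ i, discreteEig W hW i * f i ^ 2 ≤ c ^ 2) (v : W) :
    ‖powOp e lam (1 / 2) ⟨B v, hW (B v).2⟩‖ ^ 2 ≤ (c * ‖v‖) ^ 2 := by
  rw [← real_inner_self_eq_norm_sq, ← inner_discreteOp e lam W hW, mul_pow,
    ← (discreteBasis W hW).sum_inner_mul_inner, ← (discreteBasis W hW).sum_sq_norm_inner_right v,
    Finset.mul_sum]
  refine Finset.sum_le_sum fun i _ => ?_
  have h1 : inner ℝ (discreteOp e lam W hW (B v)) (discreteBasis W hW i)
      = discreteEig W hW i * (f i * inner ℝ (discreteBasis W hW i) v) := by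
    rw [discreteOp_symm, discreteOp_basis, real_inner_smul_right, real_inner_comm, h.inner_basis]
  rw [h1, h.inner_basis, Real.norm_eq_abs, sq_abs]
  calc _ = discreteEig W hW i * f i ^ 2 * inner ℝ (discreteBasis W hW i) v ^ 2 := by ring
    _ ≤ _ := by gcongr; exact hf i

theorem isDiscreteFun_semigroup (t : ℝ) :
    IsDiscreteFun W hW (fun i => Real.exp (-(t * discreteEig W hW i)))
      (discreteSemigroup e lam W hW t) := by
  intro i
  have : CompleteSpace W := FiniteDimensional.complete ℝ W
  set L : W →L[ℝ] W := -(t • discreteOp e lam W hW) with hL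
  set a : ℝ := -(t * discreteEig W hW i) with ha
  set w := discreteBasis W hW i with hw
  have hLw : L w = a • w := by
    rw [hL, _root_.neg_apply, _root_.smul_apply, hw, discreteOp_basis,
      smul_smul, ha, neg_smul]
  have hpow : ∀ n : ℕ, (L ^ n) w = a ^ n • w := by
    intro n
    induction n with
    | zero => simp
    | succ n ih => rw [pow_succ, mul_apply_eq_comp, hLw, map_smul, ih, smul_smul,
        pow_succ, mul_comm]
  have h1 := (NormedSpace.exp_series_hasSum_exp' (𝕂 := ℝ) L).mapL
    (ContinuousLinearMap.apply ℝ W w)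
  have h2 := (NormedSpace.exp_series_hasSum_exp' (𝕂 := ℝ) a).smul_const w
  have h3 : (fun n : ℕ => ContinuousLinearMap.apply ℝ W w ((n.factorial : ℝ)⁻¹ • L ^ n))
      = fun n : ℕ => ((n.factorial : ℝ)⁻¹ • a ^ n) • w := by
    funext n
    simp [hpow, smul_smul]
  rw [h3] at h1
  have h4 := h1.unique h2
  rw [← Real.exp_eq_exp_ℝ] at h4
  exact h4

theorem isDiscreteFun_inverse {c : ℝ} (hc : 0 ≤ c) :
    IsDiscreteFun W hW (fun i => (1 + c * discreteEig W hW i)⁻¹)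
      (Ring.inverse (1 + c • discreteOp e lam W hW)) := by
  set L : W →L[ℝ] W := 1 + c • discreteOp e lam W hW with hL
  have hfun : IsDiscreteFun W hW (fun i => 1 + c * discreteEig W hW i) L :=
    IsDiscreteFun.one.add (IsDiscreteFun.smul_discreteOp c)
  have hpos : ∀ i, 0 < 1 + c * discreteEig W hW i := fun i => by
    have := mul_nonneg hc (discreteEig_nonneg W hW i)
    linarith
  have hinj : Function.Injective L := by
    rw [injective_iff_map_eq_zero]
    intro v hv
    refine (discreteBasis W hW).toBasis.ext_elem_iff.2 fun i => ?_
    have := hfun.inner_basis v i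
    rw [hv, inner_zero_right] at this
    have h0 : inner ℝ (discreteBasis W hW i) v = 0 := by
      rcases mul_eq_zero.1 this.symm with h | h
      · exact absurd h (hpos i).ne'
      · exact h
    simpa [(discreteBasis W hW).repr_apply_apply] using h0
  have hsurj : Function.Surjective L :=
    LinearMap.surjective_of_injective (f := (L : W →ₗ[ℝ] W)) hinj
  have : CompleteSpace W := FiniteDimensional.complete ℝ W
  have hunit : IsUnit L := ContinuousLinearMap.isUnit_iff_bijective.2 ⟨hinj, hsurj⟩
  intro i
  have h1 : Ring.inverse L * L = 1 := Ring.inverse_mul_cancel L hunit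
  have h2 : Ring.inverse L (L (discreteBasis W hW i)) = discreteBasis W hW i := by
    rw [← mul_apply_eq_comp, h1]; rfl
  rw [hfun i, map_smul] at h2
  rw [eq_comm, inv_smul_eq_iff₀ (hpos i).ne']
  exact h2.symm

theorem isDiscreteFun_stepS {θ dt : ℝ} (h : 0 ≤ θ * dt) :
    IsDiscreteFun W hW (fun i => stabFn θ (dt * discreteEig W hW i)) (stepS e lam W hW θ dt) := by
  have := (isDiscreteFun_inverse (W := W) (hW := hW) h).mul
    ((IsDiscreteFun.one (W := W) (hW := hW)).sub (IsDiscreteFun.smul_discreteOp ((1 - θ) * dt)))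
  intro i
  rw [stepS, this i]
  congr 1
  simp only [stabFn]
  rw [div_eq_inv_mul, mul_assoc, mul_assoc]

theorem isDiscreteFun_stepT {θ dt : ℝ} (h : 0 ≤ θ * dt) :
    IsDiscreteFun W hW (fun i => (1 + θ * (dt * discreteEig W hW i))⁻¹)
      (stepT e lam W hW θ dt) := by
  simpa only [mul_assoc, stepT] using isDiscreteFun_inverse (W := W) (hW := hW) h

end Discrete

end Hilbert

/-! ### Deterministic error estimates -/

section Error

variable {H : Type*} [NormedAddCommGroup H] [InnerProductSpace ℝ H] [CompleteSpace H]
  {e : HilbertBasis ℕ ℝ H} {lam : ℕ → ℝ}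
  (W : Submodule ℝ H) [FiniteDimensional ℝ W] (hW : W ≤ (powOp e lam (1 / 2)).domain)

theorem one_div_one_add_le_rpow_neg {γ τ : ℝ} (hγ0 : 0 ≤ γ) (hγ1 : γ ≤ 1) (hτ : 0 < τ) :
    1 / (1 + τ) ≤ τ ^ (-γ) := by
  rw [Real.rpow_neg hτ.le, ← one_div]
  refine one_div_le_one_div_of_le (Real.rpow_pos_of_pos hτ _) ?_
  rcases le_total τ 1 with h | h
  · have := Real.rpow_le_one hτ.le h hγ0
    linarith
  · have := Real.rpow_le_rpow_of_exponent_le h hγ1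
    rw [Real.rpow_one] at this
    linarith

theorem isDiscreteFun_stepErr {θ dt t : ℝ} (hθ : 0 ≤ θ) (hdt : 0 < dt) (n : ℕ) :
    IsDiscreteFun W hW (fun i => -stepErr θ n (t / dt) (dt * discreteEig W hW i))
      (stepS e lam W hW θ dt ^ n * stepT e lam W hW θ dt - discreteSemigroup e lam W hW t) := by
  have h := (((isDiscreteFun_stepS (W := W) (hW := hW) (mul_nonneg hθ hdt.le)).pow n).mul
    (isDiscreteFun_stepT (mul_nonneg hθ hdt.le))).sub (isDiscreteFun_semigroup t)
  intro i
  rw [h i]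
  congr 1
  simp only [stepErr]
  have hz : t / dt * (dt * discreteEig W hW i) = t * discreteEig W hW i := by
    rw [← mul_assoc, div_mul_cancel₀ _ hdt.ne']
  rw [hz]
  ring

variable {W hW} in
/-- A function of `A_h` in the weighted norm, in terms of its values at the eigenvalues. -/
theorem IsDiscreteFun.sum_rpow_mul_sq_le {f : Fin (Module.finrank ℝ W) → ℝ} {B : W →L[ℝ] W}
    (hB : IsDiscreteFun W hW f B) {p a b : ℝ} (hlam : ∀ k, 0 < lam k) (hp0 : 0 ≤ p) (hp1 : p ≤ 1)
    (ha : 0 ≤ a) (hb : 0 ≤ b) (hf0 : ∀ i, |f i| ≤ a)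
    (hf1 : ∀ i, discreteEig W hW i * f i ^ 2 ≤ b ^ 2) (x : H) (J : Finset ℕ) :
    ∑ j ∈ J, lam j ^ p * inner ℝ (e j) (B (proj W x) : H) ^ 2
      ≤ (b ^ p * a ^ (1 - p) * ‖x‖) ^ 2 := by
  have h0 : ∑ j ∈ J, inner ℝ (e j) (B (proj W x) : H) ^ 2 ≤ (a * ‖x‖) ^ 2 := by
    refine (sum_sq_inner_le _ J).trans (pow_le_pow_left₀ (norm_nonneg _) ?_ 2)
    exact (hB.norm_le ha hf0 (proj W x)).trans
      (mul_le_mul_of_nonneg_left (norm_proj_le W x) ha)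
  have h1 : ∑ j ∈ J, lam j * inner ℝ (e j) (B (proj W x) : H) ^ 2 ≤ (b * ‖x‖) ^ 2 := by
    let y : (powOp e lam (1 / 2)).domain := ⟨B (proj W x), hW (B (proj W x)).2⟩
    refine (sum_mul_sq_inner_le_powOp hlam y J).trans ?_
    have hx : b * ‖proj W x‖ ≤ b * ‖x‖ := mul_le_mul_of_nonneg_left (norm_proj_le W x) hb
    exact (hB.norm_sqrt_le hf1 (proj W x)).trans
      (pow_le_pow_left₀ (mul_nonneg hb (norm_nonneg _)) hx 2)
  exact ImpulsiveHeat.sum_rpow_mul_sq_le hlam hp0 hp1 ha hb (norm_nonneg x) J _ h0 h1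

/-- The error of the time discretization, in the weighted norm. -/
theorem exists_time_error_bound {θ : ℝ} (hθ : θ ∈ Ioc (1 / 2 : ℝ) 1) (hlam : ∀ k, 0 < lam k) :
    ∃ C : ℝ, 0 < C ∧ ∀ (W : Submodule ℝ H) [FiniteDimensional ℝ W]
      (hW : W ≤ (powOp e lam (1 / 2)).domain) (γ p dt t : ℝ) (n : ℕ),
      0 ≤ γ → γ ≤ 1 → 0 ≤ p → p ≤ 1 → 0 < dt → 0 < t → n * dt ≤ t → t ≤ (n + 1) * dt →
      ∀ (x : H) (J : Finset ℕ),
        ∑ j ∈ J, lam j ^ p * inner ℝ (e j)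
          (((stepS e lam W hW θ dt ^ n * stepT e lam W hW θ dt
            - discreteSemigroup e lam W hW t) (proj W x) : W) : H) ^ 2
          ≤ (C * dt ^ γ * t ^ (-(γ + p / 2)) * ‖x‖) ^ 2 := by
  obtain ⟨C, hC, hbd⟩ := exists_stepErr_bound hθ
  have hθ0 : 0 < θ := by linarith [hθ.1]
  refine ⟨C, hC, fun W _ hW γ p dt t n hγ0 hγ1 hp0 hp1 hdt ht hn1 hn2 x J => ?_⟩
  set τ := t / dt with hτdef
  have hτ : 0 < τ := by positivity
  have hnτ : (n : ℝ) ≤ τ := (le_div_iff₀ hdt).2 hn1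
  have hτn : τ ≤ n + 1 := (div_le_iff₀ hdt).2 hn2
  have hfun := isDiscreteFun_stepErr (t := t) W hW hθ0.le hdt n
  rw [← hτdef] at hfun
  set μ := discreteEig W hW with hμdef
  have hμ : ∀ i, 0 ≤ μ i := discreteEig_nonneg W hW
  set a := C * τ ^ (-γ) with ha
  set b := a * t ^ (-(1 / 2 : ℝ)) with hb
  have hq := one_div_one_add_le_rpow_neg hγ0 hγ1 hτ
  have ha0 : 0 < a := mul_pos hC (Real.rpow_pos_of_pos hτ _)
  have hb0 : 0 < b := mul_pos ha0 (Real.rpow_pos_of_pos ht _)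
  have hF : ∀ i, (1 + τ * (dt * μ i)) * |stepErr θ n τ (dt * μ i)| ≤ a := by
    intro i
    have h := hbd n τ (dt * μ i) hnτ hτn (mul_nonneg hdt.le (hμ i))
    have h1 : (1 + τ * (dt * μ i)) * |stepErr θ n τ (dt * μ i)| ≤ C * (1 / (1 + τ)) := by
      rw [mul_one_div, le_div_iff₀ (by positivity)]
      linarith
    exact h1.trans (mul_le_mul_of_nonneg_left hq hC.le)
  have hF0 : ∀ i, |-stepErr θ n τ (dt * μ i)| ≤ a := by
    intro i
    rw [abs_neg]
    refine le_trans ?_ (hF i)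
    have : 0 ≤ τ * (dt * μ i) := mul_nonneg hτ.le (mul_nonneg hdt.le (hμ i))
    nlinarith [abs_nonneg (stepErr θ n τ (dt * μ i))]
  have hF1 : ∀ i, μ i * (-stepErr θ n τ (dt * μ i)) ^ 2 ≤ b ^ 2 := by
    intro i
    have hz : τ * (dt * μ i) = t * μ i := by rw [← mul_assoc, hτdef, div_mul_cancel₀ _ hdt.ne']
    have h := hF i
    rw [hz] at h
    have hz0 : 0 ≤ t * μ i := mul_nonneg ht.le (hμ i)
    have h2 : ((1 + t * μ i) * |stepErr θ n τ (dt * μ i)|) ^ 2 ≤ a ^ 2 :=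
      pow_le_pow_left₀ (by positivity) h 2
    rw [mul_pow, sq_abs] at h2
    have hb2 : b ^ 2 = a ^ 2 / t := by
      rw [hb, mul_pow, ← Real.rpow_natCast (t ^ (-(1 / 2 : ℝ))), ← Real.rpow_mul ht.le]
      norm_num [Real.rpow_neg_one, div_eq_mul_inv]
    rw [neg_sq, hb2, le_div_iff₀ ht]
    refine le_trans ?_ h2
    have : t * μ i ≤ (1 + t * μ i) ^ 2 := by nlinarith
    nlinarith [sq_nonneg (stepErr θ n τ (dt * μ i))]
  refine (hfun.sum_rpow_mul_sq_le hlam hp0 hp1 ha0.le hb0.le hF0 hF1 x J).trans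
    (le_of_eq ?_)
  congr 2
  rw [hb, Real.mul_rpow ha0.le (Real.rpow_nonneg ht.le _), ← Real.rpow_mul ht.le]
  have e1 : a ^ p * a ^ (1 - p) = a := by
    rw [← Real.rpow_add ha0]; simp
  calc a ^ p * t ^ (-(1 / 2) * p) * a ^ (1 - p)
      = (a ^ p * a ^ (1 - p)) * t ^ (-(1 / 2) * p) := by ring
    _ = C * (dt ^ γ * t ^ (-γ)) * t ^ (-(1 / 2) * p) := by
        rw [e1, ha, hτdef, Real.div_rpow ht.le hdt.le, Real.rpow_neg hdt.le, div_inv_eq_mul]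
        ring
    _ = C * dt ^ γ * (t ^ (-γ) * t ^ (-(1 / 2) * p)) := by ring
    _ = C * dt ^ γ * t ^ (-(γ + p / 2)) := by
        rw [← Real.rpow_add ht]; congr 2; ring

/-- The error of the space discretization, in the weighted norm. The exponent `2γ / (1 - p)` in the
smoothing estimate compensates for the loss in the interpolation. -/
theorem space_error_bound (hlam : ∀ k, 0 < lam k) {κ₁ κ₂ h t γ p : ℝ} (hκ₁ : 0 < κ₁)
    (hκ₂ : 0 < κ₂) (hh : 0 < h) (hh1 : h ≤ 1) (ht : 0 < t) (hp0 : 0 ≤ p)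
    (hp1 : p < 1)
    (h1 : ∀ x : H, ‖(discreteSemigroup e lam W hW t (proj W x) : H) - semigroup e lam t x‖
      ≤ κ₁ * h ^ (2 * γ / (1 - p)) * t ^ (-(2 * γ / (1 - p)) / 2) * ‖x‖)
    (h2 : ∀ x : H, ∃ y : (powOp e lam (1 / 2)).domain,
      (y : H) = (discreteSemigroup e lam W hW t (proj W x) : H) - semigroup e lam t x ∧
        ‖(y : H)‖ + ‖powOp e lam (1 / 2) y‖ ≤ κ₂ * h * t⁻¹ * ‖x‖) (x : H) (J : Finset ℕ) :
    ∑ j ∈ J, lam j ^ p * inner ℝ (e j)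
      ((discreteSemigroup e lam W hW t (proj W x) : H) - semigroup e lam t x) ^ 2
      ≤ (κ₂ ^ p * κ₁ ^ (1 - p) * h ^ (2 * γ) * t ^ (-(γ + p)) * ‖x‖) ^ 2 := by
  have hp1' : 1 - p ≠ 0 := by linarith
  set a := κ₁ * h ^ (2 * γ / (1 - p)) * t ^ (-(2 * γ / (1 - p)) / 2) with ha
  set b := κ₂ * h * t⁻¹ with hb
  have ha0 : 0 ≤ a := by positivity
  have hb0 : 0 ≤ b := by positivity
  set v := (discreteSemigroup e lam W hW t (proj W x) : H) - semigroup e lam t x with hv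
  have h0' : ∑ j ∈ J, inner ℝ (e j) v ^ 2 ≤ (a * ‖x‖) ^ 2 :=
    (sum_sq_inner_le _ J).trans (pow_le_pow_left₀ (norm_nonneg _) (h1 x) 2)
  have h1' : ∑ j ∈ J, lam j * inner ℝ (e j) v ^ 2 ≤ (b * ‖x‖) ^ 2 := by
    obtain ⟨y, hy, hyb⟩ := h2 x
    rw [hv, ← hy]
    refine (sum_mul_sq_inner_le_powOp hlam y J).trans (pow_le_pow_left₀ (norm_nonneg _) ?_ 2)
    linarith [norm_nonneg (y : H)]
  refine (sum_rpow_mul_sq_le hlam hp0 hp1.le ha0 hb0 (norm_nonneg x) J _ h0' h1').trans ?_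
  refine pow_le_pow_left₀ (by positivity) (mul_le_mul_of_nonneg_right ?_ (norm_nonneg x)) 2
  have e1 : a ^ (1 - p) = κ₁ ^ (1 - p) * h ^ (2 * γ) * t ^ (-γ) := by
    rw [ha, Real.mul_rpow (by positivity) (by positivity), Real.mul_rpow hκ₁.le (by positivity),
      ← Real.rpow_mul hh.le, ← Real.rpow_mul ht.le]
    congr 2
    · congr 1
      field_simp
    · field_simp
  have e2 : b ^ p = κ₂ ^ p * h ^ p * t ^ (-p) := by
    rw [hb, Real.mul_rpow (by positivity) (by positivity), Real.mul_rpow hκ₂.le hh.le,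
      Real.inv_rpow ht.le, Real.rpow_neg ht.le]
  have e3 : t ^ (-(γ + p)) = t ^ (-γ) * t ^ (-p) := by
    rw [← Real.rpow_add ht]; congr 1; ring
  have e4 : h ^ p ≤ 1 := Real.rpow_le_one hh.le hh1 hp0
  rw [e1, e2, e3]
  calc κ₂ ^ p * h ^ p * t ^ (-p) * (κ₁ ^ (1 - p) * h ^ (2 * γ) * t ^ (-γ))
      = h ^ p * (κ₂ ^ p * κ₁ ^ (1 - p) * h ^ (2 * γ) * (t ^ (-γ) * t ^ (-p))) := by ring
    _ ≤ _ := mul_le_of_le_one_left (by positivity) e4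

theorem sq_norm_add_le_two (x y : H) : ‖x + y‖ ^ 2 ≤ 2 * (‖x‖ ^ 2 + ‖y‖ ^ 2) := by
  have := norm_add_le x y
  nlinarith [sq_nonneg (‖x‖ - ‖y‖), norm_nonneg (x + y), norm_nonneg x, norm_nonneg y]

/-- The Hilbert–Schmidt norm of `(S_{h,Δt}^n T_{h,Δt} P_h - S(t)) R`. -/
theorem exists_hs_error_bound {θ α β γ : ℝ} (hθ : θ ∈ Ioc (1 / 2 : ℝ) 1) (hlam : ∀ k, 0 < lam k)
    (hβ : β ∈ Ioc (α - 1) α) (hγ0 : 0 ≤ γ) (hγ : γ < 1 - α + β)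
    (hTr : Summable (fun k => lam k ^ (-α))) {Q R : H →L[ℝ] H}
    (hR : ∀ x y, inner ℝ (R x) y = inner ℝ x (R y))
    (hRQ : R ∘L R = Q) (hAQ : IsBoundedComp (powOp e lam β) Q) {κ₁ κ₂ : ℝ}
    (hκ₁ : 0 < κ₁) (hκ₂ : 0 < κ₂) :
    ∃ C : ℝ, 0 < C ∧ ∀ (W : Submodule ℝ H) [FiniteDimensional ℝ W]
      (hW : W ≤ (powOp e lam (1 / 2)).domain) (h dt t : ℝ) (n : ℕ),
      0 < h → h ≤ 1 → 0 < dt → 0 < t → n * dt ≤ t → t ≤ (n + 1) * dt →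
      (∀ x : H, ‖(discreteSemigroup e lam W hW t (proj W x) : H) - semigroup e lam t x‖
        ≤ κ₁ * h ^ (2 * γ / (1 - (α - β))) * t ^ (-(2 * γ / (1 - (α - β))) / 2) * ‖x‖) →
      (∀ x : H, ∃ y : (powOp e lam (1 / 2)).domain,
        (y : H) = (discreteSemigroup e lam W hW t (proj W x) : H) - semigroup e lam t x ∧
          ‖(y : H)‖ + ‖powOp e lam (1 / 2) y‖ ≤ κ₂ * h * t⁻¹ * ‖x‖) →
      ∀ (b : HilbertBasis ℕ ℝ H) (I : Finset ℕ),
        ∑ k ∈ I, ‖((stepS e lam W hW θ dt ^ n) (stepT e lam W hW θ dt (proj W (R (b k)))) : H)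
            - semigroup e lam t (R (b k))‖ ^ 2
          ≤ (C * (h ^ (2 * γ) * t ^ (-(γ + (α - β)))
              + dt ^ γ * t ^ (-(γ + (α - β) / 2)))) ^ 2 := by
  obtain ⟨C₁, hC₁, hG2⟩ := exists_time_error_bound (e := e) (lam := lam) hθ hlam
  obtain ⟨D, hD0, hD⟩ := exists_sum_norm_sq_sqrt_le (e := e) hlam hTr hR hRQ hAQ
  set p := α - β with hp
  have hp0 : 0 ≤ p := by linarith [hβ.2]
  have hp1 : p < 1 := by linarith [hβ.1]
  have hγ1 : γ ≤ 1 := by linarith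
  set c := κ₂ ^ p * κ₁ ^ (1 - p) with hc
  have hc0 : 0 < c := mul_pos (Real.rpow_pos_of_pos hκ₂ _) (Real.rpow_pos_of_pos hκ₁ _)
  refine ⟨√(2 * (D + 1)) * (c + C₁), by positivity,
    fun W _ hW h dt t n hh hh1 hdt ht hn1 hn2 h1 h2 b I => ?_⟩
  set a₁ := h ^ (2 * γ) * t ^ (-(γ + p)) with ha₁
  set a₂ := dt ^ γ * t ^ (-(γ + p / 2)) with ha₂
  have ha₁0 : 0 ≤ a₁ := by positivity
  have ha₂0 : 0 ≤ a₂ := by positivity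
  set B := stepS e lam W hW θ dt ^ n * stepT e lam W hW θ dt - discreteSemigroup e lam W hW t
    with hB
  set G₁ : H → H := fun x => (discreteSemigroup e lam W hW t (proj W x) : H) - semigroup e lam t x
    with hG₁
  set G₂ : H → H := fun x => (B (proj W x) : H) with hG₂
  have hθ0 : 0 < θ := by linarith [hθ.1]
  have s1 : ∀ x y, inner ℝ (G₁ x) y = inner ℝ x (G₁ y) := fun x y => by
    simp only [hG₁, inner_sub_left, inner_sub_right]
    rw [inner_coe_proj_comm W (fun u v => (isDiscreteFun_semigroup t).symm u v),
      inner_semigroup_comm hlam ht.le]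
  have s2 : ∀ x y, inner ℝ (G₂ x) y = inner ℝ x (G₂ y) := fun x y =>
    inner_coe_proj_comm W (fun u v => (isDiscreteFun_stepErr W hW hθ0.le hdt n).symm u v) x y
  have k1 := sum_norm_sq_comp_le (p := p) (K := c * a₁) hlam s1 (fun x J => by
    have := space_error_bound W hW hlam hκ₁ hκ₂ hh hh1 ht hp0 hp1 h1 h2 x J
    rwa [mul_assoc c] at this) hR hD b I
  have k2 := sum_norm_sq_comp_le (p := p) (K := C₁ * a₂) hlam s2 (fun x J => by
    have := hG2 W hW γ p dt t n hγ0 hγ1 hp0 hp1.le hdt ht hn1 hn2 x J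
    rwa [mul_assoc C₁] at this) hR hD b I
  have hsplit : ∀ k, ((stepS e lam W hW θ dt ^ n) (stepT e lam W hW θ dt (proj W (R (b k)))) : H)
      - semigroup e lam t (R (b k)) = G₁ (R (b k)) + G₂ (R (b k)) := by
    intro k
    simp only [hG₁, hG₂, hB, _root_.sub_apply, mul_apply_eq_comp, Submodule.coe_sub]
    abel
  calc ∑ k ∈ I, ‖((stepS e lam W hW θ dt ^ n) (stepT e lam W hW θ dt (proj W (R (b k)))) : H)
            - semigroup e lam t (R (b k))‖ ^ 2
      ≤ ∑ k ∈ I, 2 * (‖G₁ (R (b k))‖ ^ 2 + ‖G₂ (R (b k))‖ ^ 2) := by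
        refine Finset.sum_le_sum fun k _ => ?_
        rw [hsplit]
        exact sq_norm_add_le_two _ _
    _ = 2 * (∑ k ∈ I, ‖G₁ (R (b k))‖ ^ 2 + ∑ k ∈ I, ‖G₂ (R (b k))‖ ^ 2) := by
        rw [← Finset.mul_sum, Finset.sum_add_distrib]
    _ ≤ 2 * ((c * a₁) ^ 2 * D + (C₁ * a₂) ^ 2 * D) := by gcongr
    _ ≤ 2 * (D + 1) * (c * a₁ + C₁ * a₂) ^ 2 := by
        have := mul_nonneg (mul_nonneg hc0.le ha₁0) (mul_nonneg hC₁.le ha₂0)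
        nlinarith [sq_nonneg (c * a₁), sq_nonneg (C₁ * a₂), mul_nonneg hD0 this]
    _ ≤ 2 * (D + 1) * ((c + C₁) * (a₁ + a₂)) ^ 2 := by
        gcongr
        nlinarith [mul_nonneg hc0.le ha₂0, mul_nonneg hC₁.le ha₁0]
    _ = (√(2 * (D + 1)) * (c + C₁) * (a₁ + a₂)) ^ 2 := by
        rw [mul_assoc (√_), mul_pow (√_), Real.sq_sqrt (by positivity)]

/-- The error of the deterministic part at the final time. -/
theorem exists_initial_error_bound {θ T γ κ₁ : ℝ} (hθ : θ ∈ Ioc (1 / 2 : ℝ) 1) (hT : 1 ≤ T)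
    (hγ0 : 0 ≤ γ) (hγ1 : γ ≤ 1) (hκ₁ : 0 < κ₁) :
    ∃ C : ℝ, 0 < C ∧ ∀ (W : Submodule ℝ H) [FiniteDimensional ℝ W]
      (hW : W ≤ (powOp e lam (1 / 2)).domain) (h : ℝ) (N : ℕ),
      0 < h → 1 ≤ N → T / N ≤ 1 →
      (∀ x : H, ‖(discreteSemigroup e lam W hW T (proj W x) : H) - semigroup e lam T x‖
        ≤ κ₁ * h ^ (2 * γ) * T ^ (-(2 * γ) / 2) * ‖x‖) →
      ∀ x : H, ‖((stepS e lam W hW θ (T / N) ^ N) (proj W x) : H) - semigroup e lam T x‖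
          ≤ C * (h ^ (2 * γ) + (T / N) ^ γ) * ‖x‖ := by
  obtain ⟨C, hC, hbd⟩ := exists_stabFn_pow_bound hθ
  have hθ0 : 0 < θ := by linarith [hθ.1]
  refine ⟨κ₁ + C, by positivity, fun W _ hW h N hh hN hdt1 h1 x => ?_⟩
  have hN' : (1 : ℝ) ≤ N := by exact_mod_cast hN
  have hN0 : (0 : ℝ) < N := by linarith
  have hT0 : 0 < T := by linarith
  set dt := T / N with hdt
  have hdt0 : 0 < dt := by positivity
  have hNdt : N * dt = T := by rw [hdt]; field_simp
  have hfun : IsDiscreteFun W hW _ (stepS e lam W hW θ dt ^ N - discreteSemigroup e lam W hW T) :=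
    ((isDiscreteFun_stepS (mul_nonneg hθ0.le hdt0.le)).pow N).sub (isDiscreteFun_semigroup T)
  have hb := hfun.norm_le (c := C * dt ^ γ) (by positivity) (fun i => by
    have h := hbd N (dt * discreteEig W hW i) hN (mul_nonneg hdt0.le (discreteEig_nonneg W hW i))
    rw [← mul_assoc, hNdt, abs_sub_comm, ← le_div_iff₀' hN0] at h
    refine h.trans ?_
    rw [div_eq_mul_inv]
    refine mul_le_mul_of_nonneg_left ?_ hC.le
    have h2 : (N : ℝ)⁻¹ ≤ dt := by
      rw [hdt, div_eq_mul_inv]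
      exact le_mul_of_one_le_left (by positivity) hT
    have h3 := Real.rpow_le_rpow_of_exponent_ge hdt0 hdt1 hγ1
    rw [Real.rpow_one] at h3
    exact h2.trans h3) (proj W x)
  have hb' : ‖((stepS e lam W hW θ dt ^ N) (proj W x) : H)
      - (discreteSemigroup e lam W hW T (proj W x) : H)‖ ≤ C * dt ^ γ * ‖x‖ := by
    refine le_trans (le_of_eq ?_)
      (hb.trans (mul_le_mul_of_nonneg_left (norm_proj_le W x) (by positivity)))
    rw [_root_.sub_apply, ← Submodule.coe_sub, Submodule.coe_norm]
  have hTγ : T ^ (-(2 * γ) / 2) ≤ 1 :=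
    Real.rpow_le_one_of_one_le_of_nonpos hT (by linarith)
  have ha' : ‖(discreteSemigroup e lam W hW T (proj W x) : H) - semigroup e lam T x‖
      ≤ κ₁ * h ^ (2 * γ) * ‖x‖ := by
    refine (h1 x).trans (mul_le_mul_of_nonneg_right ?_ (norm_nonneg _))
    exact mul_le_of_le_one_right (by positivity) hTγ
  calc _ ≤ _ := norm_sub_le_norm_sub_add_norm_sub _
        (discreteSemigroup e lam W hW T (proj W x) : H) _
    _ ≤ C * dt ^ γ * ‖x‖ + κ₁ * h ^ (2 * γ) * ‖x‖ := add_le_add hb' ha'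
    _ = (C * dt ^ γ + κ₁ * h ^ (2 * γ)) * ‖x‖ := by ring
    _ ≤ _ := by
        refine mul_le_mul_of_nonneg_right ?_ (norm_nonneg _)
        have : 0 ≤ dt ^ γ := by positivity
        have : 0 ≤ h ^ (2 * γ) := by positivity
        nlinarith

end Error

/-! ### The `L¹` bound for cylindrical integrals -/

section Cylindrical

theorem memLp_sum_smul {X : Type*} [MeasurableSpace X] {μ : Measure X} {F : Type*}
    [NormedAddCommGroup F] [NormedSpace ℝ F] (b : ℕ → Lp ℝ 2 μ) (v : ℕ → F) (I : Finset ℕ) :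
    MemLp (fun ξ => ∑ m ∈ I, (b m ξ) • v m) 2 μ :=
  memLp_finsetSum _ fun m _ =>
    (ContinuousLinearMap.toSpanSingleton ℝ (v m)).comp_memLp' (Lp.memLp (b m))

/-- Parseval's identity for an orthonormal system of `L²(μ)` with vector coefficients. -/
theorem integral_norm_sq_sum_smul {X : Type*} [MeasurableSpace X] {μ : Measure X} {F : Type*}
    [NormedAddCommGroup F] [InnerProductSpace ℝ F] {b : ℕ → Lp ℝ 2 μ} (hb : Orthonormal ℝ b)
    (v : ℕ → F) (I : Finset ℕ) :
    ∫ ξ, ‖∑ m ∈ I, (b m ξ) • v m‖ ^ 2 ∂μ = ∑ m ∈ I, ‖v m‖ ^ 2 := by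
  have h1 : ∀ ξ, ‖∑ m ∈ I, (b m ξ) • v m‖ ^ 2
      = ∑ m ∈ I, ∑ l ∈ I, (b m ξ * b l ξ) * inner ℝ (v m) (v l) := by
    intro ξ
    rw [← real_inner_self_eq_norm_sq, sum_inner]
    refine Finset.sum_congr rfl fun m _ => ?_
    rw [inner_sum]
    refine Finset.sum_congr rfl fun l _ => ?_
    rw [real_inner_smul_left, real_inner_smul_right]
    ring
  have hint : ∀ m l, Integrable (fun ξ => (b m ξ * b l ξ) * inner ℝ (v m) (v l)) μ := fun m l =>
    (MemLp.integrable_mul (Lp.memLp (b m)) (Lp.memLp (b l))).mul_const _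
  have hin : ∀ m l, ∫ ξ, b m ξ * b l ξ ∂μ = inner ℝ (b m) (b l) := by
    intro m l
    rw [L2.inner_def]
    refine integral_congr_ae (ae_of_all _ fun ξ => ?_)
    simp [mul_comm]
  simp_rw [h1]
  rw [integral_finsetSum _ fun m _ => integrable_finsetSum _ fun l _ => hint m l]
  refine Finset.sum_congr rfl fun m hm => ?_
  rw [integral_finsetSum _ fun l _ => hint m l, Finset.sum_eq_single_of_mem m hm]
  · rw [integral_mul_const, hin, real_inner_self_eq_norm_sq, real_inner_self_eq_norm_sq, hb.1 m]
    ring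
  · intro l _ hl
    rw [integral_mul_const, hin, hb.2 hl.symm, zero_mul]

theorem lintegral_enorm_sum_smul_le {X : Type*} [MeasurableSpace X] {μ : Measure X} {F : Type*}
    [NormedAddCommGroup F] [InnerProductSpace ℝ F] {b : ℕ → Lp ℝ 2 μ} (hb : Orthonormal ℝ b)
    (v : ℕ → F) (I : Finset ℕ) {k : ℝ} (hk : 0 ≤ k) (h : ∑ m ∈ I, ‖v m‖ ^ 2 ≤ k ^ 2) :
    ∫⁻ ξ, ‖∑ m ∈ I, (b m ξ) • v m‖ₑ ∂μ ≤ ENNReal.ofReal k * μ univ ^ (1 / 2 : ℝ) := by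
  have hm := memLp_sum_smul b v I
  have h2 : eLpNorm (fun ξ => ∑ m ∈ I, (b m ξ) • v m) 2 μ ≤ ENNReal.ofReal k := by
    rw [hm.eLpNorm_eq_integral_rpow_norm (by norm_num) (by norm_num)]
    simp only [ENNReal.toReal_ofNat, Real.rpow_ofNat]
    rw [integral_norm_sq_sum_smul hb]
    refine ENNReal.ofReal_le_ofReal ?_
    have h3 : (k ^ 2) ^ (2 : ℝ)⁻¹ = k := by
      rw [← Real.rpow_natCast, ← Real.rpow_mul hk]; norm_num
    rw [← h3]
    exact Real.rpow_le_rpow (Finset.sum_nonneg fun _ _ => sq_nonneg _) h (by norm_num)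
  rw [← eLpNorm_one_eq_lintegral_enorm]
  refine (eLpNorm_le_eLpNorm_mul_rpow_measure_univ (p := 1) (q := 2) (by norm_num) hm.1).trans ?_
  norm_num
  gcongr

variable {d : ℕ} {O : Set (EuclideanSpace ℝ (Fin d))} {ν : Measure ℝ} [SigmaFinite ν]
  {F : Type*} [NormedAddCommGroup F] [InnerProductSpace ℝ F]

/-- The `L¹(dt dξ ν(dσ))` norm of `b_k(ξ) σ v_k(t)`, summed over `k`: the Hilbert–Schmidt norm of
the integrand is integrated only to the first power in time. -/
theorem eLpNorm_one_cylindrical_le (b : HilbertBasis ℕ ℝ (L2 O)) {T : ℝ}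
    (hν : ∫⁻ σ, ‖σ‖ₑ ∂ν ≠ ∞) (hO : volume O ≠ ∞) (v : ℕ → ℝ → F) (I : Finset ℕ)
    (hv : AEStronglyMeasurable (fun p => ∑ m ∈ I, (Icc 0 T ×ˢ univ).indicator
      (fun p : ℝ × EuclideanSpace ℝ (Fin d) × ℝ => ((b m) p.2.1 * p.2.2) • v m p.1) p)
      (refMeasure O ν))
    {k : ℝ → ℝ} (hk0 : ∀ s ∈ Ioo 0 T, 0 ≤ k s) (hk : ∀ s ∈ Ioo 0 T, ∑ m ∈ I, ‖v m s‖ ^ 2 ≤ k s ^ 2) :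
    eLpNorm (fun p => ∑ m ∈ I, (Icc 0 T ×ˢ univ).indicator
      (fun p : ℝ × EuclideanSpace ℝ (Fin d) × ℝ => ((b m) p.2.1 * p.2.2) • v m p.1) p) 1
      (refMeasure O ν)
      ≤ (∫⁻ σ, ‖σ‖ₑ ∂ν) * volume O ^ (1 / 2 : ℝ) * ∫⁻ s in Ioo 0 T, ENNReal.ofReal (k s) := by
  set c := (∫⁻ σ, ‖σ‖ₑ ∂ν) * volume O ^ (1 / 2 : ℝ) with hc
  have hc_top : c ≠ ∞ := ENNReal.mul_ne_top hν (ENNReal.rpow_ne_top_of_nonneg (by norm_num) hO)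
  rw [eLpNorm_one_eq_lintegral_enorm]
  unfold refMeasure at hv ⊢
  rw [lintegral_prod _ hv.enorm]
  have hne : ∀ᵐ s : ℝ ∂(volume.restrict (Ici 0)), s ≠ 0 ∧ s ≠ T :=
    ae_restrict_of_ae ((Measure.ae_ne volume 0).and (Measure.ae_ne volume T))
  calc _ ≤ ∫⁻ s in Ici 0, (Ioo 0 T).indicator (fun s => c * ENNReal.ofReal (k s)) s := by
        refine lintegral_mono_ae ?_
        filter_upwards [hne] with s hs
        by_cases hsT : s ∈ Icc 0 T
        · have hs' : s ∈ Ioo 0 T := ⟨lt_of_le_of_ne hsT.1 hs.1.symm, lt_of_le_of_ne hsT.2 hs.2⟩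
          rw [indicator_of_mem hs']
          have e1 : ∀ y : EuclideanSpace ℝ (Fin d) × ℝ,
              ‖∑ m ∈ I, (Icc 0 T ×ˢ univ).indicator
              (fun p : ℝ × EuclideanSpace ℝ (Fin d) × ℝ => ((b m) p.2.1 * p.2.2) • v m p.1)
                (s, y)‖ₑ = ‖∑ m ∈ I, (b m y.1) • v m s‖ₑ * ‖y.2‖ₑ := by
            intro y
            have : ∀ m ∈ I, (Icc 0 T ×ˢ univ).indicator
              (fun p : ℝ × EuclideanSpace ℝ (Fin d) × ℝ => ((b m) p.2.1 * p.2.2) • v m p.1) (s, y)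
                = y.2 • ((b m y.1) • v m s) := by
              intro m _
              rw [indicator_of_mem (by simpa using hsT), smul_smul, mul_comm]
            rw [Finset.sum_congr rfl this, ← Finset.smul_sum, enorm_smul, mul_comm]
          simp_rw [e1]
          rw [lintegral_prod_mul (memLp_sum_smul (fun m => b m) (fun m => v m s) I).1.enorm
            (by fun_prop)]
          have h1 := lintegral_enorm_sum_smul_le (b := fun m => b m) b.orthonormal
            (fun m => v m s) I (hk0 s hs') (hk s hs')
          rw [Measure.restrict_apply_univ] at h1
          calc _ ≤ (ENNReal.ofReal (k s) * volume O ^ (1 / 2 : ℝ)) * ∫⁻ σ, ‖σ‖ₑ ∂ν := by gcongr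
            _ = c * ENNReal.ofReal (k s) := by rw [hc]; ring
        · have e1 : ∀ y : EuclideanSpace ℝ (Fin d) × ℝ,
              ‖∑ m ∈ I, (Icc 0 T ×ˢ univ).indicator
              (fun p : ℝ × EuclideanSpace ℝ (Fin d) × ℝ => ((b m) p.2.1 * p.2.2) • v m p.1)
                (s, y)‖ₑ = 0 := by
            intro y
            rw [Finset.sum_eq_zero, enorm_zero]
            intro m _
            exact indicator_of_notMem (fun h => hsT h.1) _
          simp_rw [e1]
          simp
    _ ≤ ∫⁻ s, (Ioo 0 T).indicator (fun s => c * ENNReal.ofReal (k s)) s :=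
        setLIntegral_le_lintegral _ _
    _ = c * ∫⁻ s in Ioo 0 T, ENNReal.ofReal (k s) := by
        rw [lintegral_indicator measurableSet_Ioo, lintegral_const_mul' _ _ hc_top]

theorem lintegral_sub_rpow_lt_top {T a : ℝ} (hT : 0 ≤ T) (ha : a < 1) :
    ∫⁻ s in Ioo 0 T, ENNReal.ofReal ((T - s) ^ (-a)) < ∞ := by
  have h1 : IntervalIntegrable (fun x : ℝ => x ^ (-a)) volume 0 T :=
    intervalIntegral.intervalIntegrable_rpow' (by linarith)
  have h2 := (h1.comp_sub_left T).symm
  rw [sub_zero, sub_self, intervalIntegrable_iff_integrableOn_Ioo_of_le hT] at h2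
  exact (hasFiniteIntegral_iff_ofReal ((ae_restrict_iff' measurableSet_Ioo).2
    (ae_of_all _ fun s hs => Real.rpow_nonneg (by linarith [hs.2]) _))).1 h2.2

/-- Every time in `(0, T)` lies in exactly one step of the grid. -/
theorem exists_grid_index {T : ℝ} {N : ℕ} (hT : 0 < T) (hN : 1 ≤ N) {s : ℝ} (hs : s ∈ Ioo 0 T) :
    ∃ k < N, k * (T / N) < s ∧ s ≤ (k + 1) * (T / N) := by
  have hN0 : (0 : ℝ) < N := by exact_mod_cast hN
  have hdt : 0 < T / N := by positivity
  have hx : 0 < s / (T / N) := div_pos hs.1 hdt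
  have hc : 0 < ⌈s / (T / N)⌉₊ := Nat.ceil_pos.2 hx
  obtain ⟨k, hk⟩ := Nat.exists_eq_add_of_lt hc
  rw [zero_add] at hk
  have h1 : (k : ℝ) < s / (T / N) := by
    rw [← Nat.lt_ceil]; omega
  have h2 : s / (T / N) ≤ (k + 1 : ℕ) := by rw [← hk]; exact Nat.le_ceil _
  push_cast at h2
  rw [lt_div_iff₀ hdt] at h1
  rw [div_le_iff₀ hdt] at h2
  refine ⟨k, ?_, h1, h2⟩
  have h3 : (k : ℝ) * (T / N) < N * (T / N) := by
    rw [mul_div_cancel₀ _ hN0.ne']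
    linarith [hs.2]
  exact_mod_cast lt_of_mul_lt_mul_right h3 hdt.le

/-- The step function with increments on the grid takes the value `w k` on the `k`-th step
`(k Δt, (k + 1) Δt]`. -/
theorem sum_grid_indicator_smul {N : ℕ} {dt : ℝ} (hdt : 0 < dt) {s : ℝ} (hs : 0 ≤ s) {k : ℕ}
    (hk : k < N) (h1 : k * dt < s) (h2 : s ≤ (k + 1) * dt) (w : ℕ → F) :
    ∑ i ∈ Finset.range N, ((Icc 0 ((i + 1) * dt)).indicator (1 : ℝ → ℝ) s
      - (Icc 0 (i * dt)).indicator (1 : ℝ → ℝ) s) • w i = w k := by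
  rw [Finset.sum_eq_single_of_mem k (Finset.mem_range.2 hk)]
  · rw [indicator_of_mem (show s ∈ Icc 0 _ from ⟨hs, h2⟩), indicator_of_notMem (fun h => absurd h.2 (not_le.2 h1))]
    simp
  · intro i _ hik
    rcases lt_or_gt_of_ne hik with h | h
    · have hi : ((i : ℝ) + 1) ≤ k := by exact_mod_cast h
      have hi' : ((i : ℝ) + 1) * dt < s := by nlinarith
      have hi2 : (i : ℝ) * dt < s := by nlinarith
      rw [indicator_of_notMem (fun h => absurd h.2 (not_le.2 hi')),
        indicator_of_notMem (fun h => absurd h.2 (not_le.2 hi2))]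
      simp
    · have hi : ((k : ℝ) + 1) ≤ i := by exact_mod_cast h
      have hi2 : s ≤ (i : ℝ) * dt := by nlinarith
      have hi' : s ≤ ((i : ℝ) + 1) * dt := by nlinarith
      rw [indicator_of_mem (show s ∈ Icc 0 _ from ⟨hs, hi'⟩),
        indicator_of_mem (show s ∈ Icc 0 _ from ⟨hs, hi2⟩)]
      simp

theorem IsCompensatedIntegral.memLp {Ω : Type*} [MeasurableSpace Ω] {E : Type*} [MeasurableSpace E]
    {m : Measure E} {π : Ω → Measure E} {P : Measure Ω} {f : E → F} {Y : Ω → F}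
    (h : IsCompensatedIntegral m π P f Y) : MemLp Y 2 P := by
  obtain ⟨_, _, _, _, h⟩ := h
  exact h.1

/-- The `L¹` distance between a sum of increments of the cylindrical process, i.e. the stochastic
integral of a step function with values `w · k`, and a stochastic integral. -/
theorem eLpNorm_one_sum_increments_sub_integral_le {Ω : Type*} [MeasurableSpace Ω] {P : Measure Ω}
    [IsProbabilityMeasure P] {π : Ω → Measure (ℝ × EuclideanSpace ℝ (Fin d) × ℝ)}
    (hπ : IsPoissonRandomMeasure (refMeasure O ν) π P) {b : HilbertBasis ℕ ℝ (L2 O)} {T : ℝ}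
    (hT : 0 < T) {Z : ℕ → ℝ → Ω → ℝ} (hZ : IsImpulsiveCylindrical O ν P π b T Z)
    (hν : ∫⁻ σ, ‖σ‖ₑ ∂ν ≠ ∞) (hO : volume O ≠ ∞) {N : ℕ} (hN : 1 ≤ N) {w : ℕ → ℕ → F}
    {K : ℕ → Ω → F} (hK : ∀ k < N, IsL2Limit P (fun M ω => ∑ m ∈ Finset.range M,
      (Z m ((k + 1) * (T / N)) ω - Z m (k * (T / N)) ω) • w m k) (K k))
    {Ψ : ℝ → L2 O → F} {Y : Ω → F} (hY : IsCylindricalIntegral O ν P π b T Ψ Y)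
    {κ : ℝ → ℝ} (hκ0 : ∀ s ∈ Ioo 0 T, 0 ≤ κ s) (hκ : ∀ (M : ℕ), ∀ k < N, ∀ s ∈ Ioo 0 T,
      k * (T / N) < s → s ≤ (k + 1) * (T / N) →
        ∑ m ∈ Finset.range M, ‖w m k - Ψ s (b m)‖ ^ 2 ≤ κ s ^ 2) :
    eLpNorm (∑ k ∈ Finset.range N, K k - Y) 1 P
      ≤ 2 * ((∫⁻ σ, ‖σ‖ₑ ∂ν) * volume O ^ (1 / 2 : ℝ)
        * ∫⁻ s in Ioo 0 T, ENNReal.ofReal (κ s)) := by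
  obtain ⟨I, hI, hYI⟩ := hY
  have hN0 : (0 : ℝ) < N := by exact_mod_cast hN
  have hdt : 0 < T / N := by positivity
  have hgrid : ∀ k < N, (k * (T / N) : ℝ) ∈ Icc 0 T ∧ ((k + 1) * (T / N) : ℝ) ∈ Icc 0 T := by
    intro k hk
    have hk' : (k : ℝ) + 1 ≤ N := by exact_mod_cast hk
    have hNT : N * (T / N) = T := by field_simp
    refine ⟨⟨by positivity, ?_⟩, ⟨by positivity, ?_⟩⟩ <;> nlinarith
  -- the summands as integrals of one common integrand
  have hinc : ∀ m, ∀ k < N, IsCompensatedIntegral (refMeasure O ν) π P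
      (fun p => ((Icc 0 ((k + 1) * (T / N)) ×ˢ univ).indicator
        (fun p : ℝ × EuclideanSpace ℝ (Fin d) × ℝ => (b m) p.2.1 * p.2.2) p
        - (Icc 0 (k * (T / N)) ×ˢ univ).indicator
        (fun p : ℝ × EuclideanSpace ℝ (Fin d) × ℝ => (b m) p.2.1 * p.2.2) p) • w m k)
      (fun ω => (Z m ((k + 1) * (T / N)) ω - Z m (k * (T / N)) ω) • w m k) := fun m k hk =>
    ((hZ m _ (hgrid k hk).2).sub hπ (hZ m _ (hgrid k hk).1)).clm hπ
      (ContinuousLinearMap.toSpanSingleton ℝ (w m k))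
  set v : ℕ → ℝ → F := fun m s => ∑ k ∈ Finset.range N,
    ((Icc 0 ((k + 1) * (T / N))).indicator (1 : ℝ → ℝ) s
      - (Icc 0 (k * (T / N))).indicator (1 : ℝ → ℝ) s) • w m k - Ψ s (b m) with hv
  have hone : ∀ m, IsCompensatedIntegral (refMeasure O ν) π P
      ((Icc 0 T ×ˢ univ).indicator
        (fun p : ℝ × EuclideanSpace ℝ (Fin d) × ℝ => ((b m) p.2.1 * p.2.2) • v m p.1))
      (∑ k ∈ Finset.range N, (fun ω => (Z m ((k + 1) * (T / N)) ω - Z m (k * (T / N)) ω) • w m k)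
        - I m) := by
    intro m
    refine ((IsCompensatedIntegral.sum hπ (Finset.range N)
      fun k hk => hinc m k (Finset.mem_range.1 hk)).sub hπ (hI m)).congr
      (ae_of_all _ fun p => ?_) (ae_eq_refl _)
    have hind : ∀ t : ℝ, (Icc 0 t ×ˢ univ).indicator
        (fun p : ℝ × EuclideanSpace ℝ (Fin d) × ℝ => (b m) p.2.1 * p.2.2) p
        = (Icc 0 t).indicator (1 : ℝ → ℝ) p.1 * ((b m) p.2.1 * p.2.2) := by
      intro t
      by_cases h : p.1 ∈ Icc 0 t
      · rw [indicator_of_mem (by exact ⟨h, mem_univ _⟩), indicator_of_mem h, Pi.one_apply, one_mul]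
      · rw [indicator_of_notMem (fun h' => h h'.1), indicator_of_notMem h, zero_mul]
    have hsum : (∑ k ∈ Finset.range N, fun p : ℝ × EuclideanSpace ℝ (Fin d) × ℝ =>
        ((Icc 0 ((k + 1) * (T / N)) ×ˢ univ).indicator
        (fun p : ℝ × EuclideanSpace ℝ (Fin d) × ℝ => (b m) p.2.1 * p.2.2) p
        - (Icc 0 (k * (T / N)) ×ˢ univ).indicator
        (fun p : ℝ × EuclideanSpace ℝ (Fin d) × ℝ => (b m) p.2.1 * p.2.2) p) • w m k) p
        = ((b m) p.2.1 * p.2.2) • ∑ k ∈ Finset.range N,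
          ((Icc 0 ((k + 1) * (T / N))).indicator (1 : ℝ → ℝ) p.1
            - (Icc 0 (k * (T / N))).indicator (1 : ℝ → ℝ) p.1) • w m k := by
      rw [Finset.sum_apply, Finset.smul_sum]
      refine Finset.sum_congr rfl fun k _ => ?_
      rw [hind, hind, smul_smul]
      congr 1
      ring
    rw [Pi.sub_apply, hsum]
    by_cases h : p.1 ∈ Icc 0 T
    · have hp : p ∈ Icc 0 T ×ˢ (univ : Set (EuclideanSpace ℝ (Fin d) × ℝ)) := ⟨h, mem_univ _⟩
      rw [indicator_of_mem hp, indicator_of_mem hp, ← smul_sub]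
    · have hp : p ∉ Icc 0 T ×ˢ (univ : Set (EuclideanSpace ℝ (Fin d) × ℝ)) := fun h' => h h'.1
      rw [indicator_of_notMem hp, indicator_of_notMem hp, sub_zero, Finset.sum_eq_zero, smul_zero]
      intro k hk
      have hg := hgrid k (Finset.mem_range.1 hk)
      rw [indicator_of_notMem (fun h' => h ⟨h'.1, h'.2.trans hg.2.2⟩),
        indicator_of_notMem (fun h' => h ⟨h'.1, h'.2.trans hg.1.2⟩), sub_zero, zero_smul]
  have hsumM : ∀ M : ℕ, IsCompensatedIntegral (refMeasure O ν) π P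
      (fun p => ∑ m ∈ Finset.range M, (Icc 0 T ×ˢ univ).indicator
        (fun p : ℝ × EuclideanSpace ℝ (Fin d) × ℝ => ((b m) p.2.1 * p.2.2) • v m p.1) p)
      (∑ m ∈ Finset.range M, (∑ k ∈ Finset.range N,
        (fun ω => (Z m ((k + 1) * (T / N)) ω - Z m (k * (T / N)) ω) • w m k) - I m)) := by
    intro M
    refine (IsCompensatedIntegral.sum hπ (Finset.range M) fun m _ => hone m).congr
      (ae_of_all _ fun p => ?_) (ae_eq_refl _)
    rw [Finset.sum_apply]
  have hmeasK : ∀ k < N, ∀ M, AEStronglyMeasurable (fun ω => ∑ m ∈ Finset.range M,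
      (Z m ((k + 1) * (T / N)) ω - Z m (k * (T / N)) ω) • w m k) P := fun k hk M =>
    Finset.aestronglyMeasurable_fun_sum _ fun m _ => (hinc m k hk).memLp.1
  have hmeasI : ∀ M, AEStronglyMeasurable (fun ω => ∑ m ∈ Finset.range M, I m ω) P := fun M =>
    Finset.aestronglyMeasurable_fun_sum _ fun m _ => (hI m).memLp.1
  have hlim : IsL2Limit P (fun M => ∑ m ∈ Finset.range M, (∑ k ∈ Finset.range N,
        (fun ω => (Z m ((k + 1) * (T / N)) ω - Z m (k * (T / N)) ω) • w m k) - I m))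
        (∑ k ∈ Finset.range N, K k - Y) := by
    have h1 := IsL2Limit.sum (Finset.range N) (fun k hk => hK k (Finset.mem_range.1 hk))
      fun k hk => hmeasK k (Finset.mem_range.1 hk)
    have h2 := hYI.clm (-ContinuousLinearMap.id ℝ F)
    refine (h1.add h2 (fun M => Finset.aestronglyMeasurable_sum _ fun k hk =>
      hmeasK k (Finset.mem_range.1 hk) M) (fun M => by simpa [Pi.neg_def] using (hmeasI M).neg)).congr
      (fun M => ae_of_all _ fun ω => ?_) (ae_of_all _ fun ω => ?_)
    · simp only [Pi.add_apply, Finset.sum_apply, Pi.sub_apply, Finset.sum_sub_distrib]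
      rw [Finset.sum_comm]
      simp [sub_eq_add_neg]
    · simp [sub_eq_add_neg]
  refine hlim.eLpNorm_one_le (fun M => (hsumM M).memLp.1) tendsto_const_nhds fun M => ?_
  refine ((hsumM M).eLpNorm_one_le hπ).trans ?_
  gcongr
  refine eLpNorm_one_cylindrical_le b hν hO v (Finset.range M) (hsumM M).1.1 hκ0 fun s hs => ?_
  obtain ⟨k, hkN, hk1, hk2⟩ := exists_grid_index hT hN hs
  have : ∀ m, v m s = w m k - Ψ s (b m) := by
    intro m
    simp only [hv]
    rw [sum_grid_indicator_smul hdt hs.1.le hkN hk1 hk2]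
  simp_rw [this]
  exact hκ M k hkN s hs hk1 hk2

end Cylindrical

/-! ### The error of the scheme -/

section Final

variable {d : ℕ} {O : Set (EuclideanSpace ℝ (Fin d))} {lam : ℕ → ℝ} {e : HilbertBasis ℕ ℝ (L2 O)}
  {R : L2 O →L[ℝ] L2 O} {ν : Measure ℝ}

theorem lintegral_enorm_ne_top (hν : ∫⁻ σ, ENNReal.ofReal (max |σ| (σ ^ 2)) ∂ν < ∞) :
    ∫⁻ σ, ‖σ‖ₑ ∂ν ≠ ∞ := by
  refine (lt_of_le_of_lt (lintegral_mono fun σ => ?_) hν).ne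
  rw [← ofReal_norm, Real.norm_eq_abs]
  exact ENNReal.ofReal_le_ofReal (le_max_left _ _)

/-- The time integral of the bound for the Hilbert–Schmidt norms; the singularities at the final
time are integrable. -/
theorem exists_lintegral_kernel_le {T C a b : ℝ} (hT : 0 ≤ T) (hC : 0 ≤ C) (ha : a < 1)
    (hb : b < 1) {c : ℝ≥0∞} (hc : c ≠ ∞) :
    ∃ C' : ℝ, 0 ≤ C' ∧ ∀ x y : ℝ, 0 ≤ x → 0 ≤ y →
      c * ∫⁻ s in Ioo 0 T, ENNReal.ofReal (C * (x * (T - s) ^ (-a) + y * (T - s) ^ (-b)))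
        ≤ ENNReal.ofReal (C' * (x + y)) := by
  set A := ∫⁻ s in Ioo 0 T, ENNReal.ofReal ((T - s) ^ (-a)) with hA
  set B := ∫⁻ s in Ioo 0 T, ENNReal.ofReal ((T - s) ^ (-b)) with hB
  have hA' : A ≠ ∞ := (lintegral_sub_rpow_lt_top hT ha).ne
  have hB' : B ≠ ∞ := (lintegral_sub_rpow_lt_top hT hb).ne
  refine ⟨c.toReal * (C * (A.toReal + B.toReal)), by positivity, fun x y hx hy => ?_⟩
  have hmeas : ∀ (z q : ℝ), Measurable fun s : ℝ => ENNReal.ofReal (C * z) *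
      ENNReal.ofReal ((T - s) ^ q) := by
    intro z q
    fun_prop
  have h1 : ∫⁻ s in Ioo 0 T, ENNReal.ofReal (C * (x * (T - s) ^ (-a) + y * (T - s) ^ (-b)))
      ≤ ENNReal.ofReal (C * x) * A + ENNReal.ofReal (C * y) * B := by
    calc _ ≤ ∫⁻ s in Ioo 0 T, (ENNReal.ofReal (C * x) * ENNReal.ofReal ((T - s) ^ (-a))
          + ENNReal.ofReal (C * y) * ENNReal.ofReal ((T - s) ^ (-b))) := by
          refine lintegral_mono fun s => ?_
          rw [mul_add, ← mul_assoc, ← mul_assoc]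
          refine ENNReal.ofReal_add_le.trans ?_
          rw [ENNReal.ofReal_mul (mul_nonneg hC hx), ENNReal.ofReal_mul (mul_nonneg hC hy)]
      _ = _ := by
          rw [lintegral_add_left (hmeas _ _), lintegral_const_mul' _ _ ENNReal.ofReal_ne_top,
            lintegral_const_mul' _ _ ENNReal.ofReal_ne_top]
  calc _ ≤ c * (ENNReal.ofReal (C * x) * A + ENNReal.ofReal (C * y) * B) := by gcongr
    _ = ENNReal.ofReal (c.toReal * (C * x * A.toReal + C * y * B.toReal)) := by
        rw [ENNReal.ofReal_mul ENNReal.toReal_nonneg, ENNReal.ofReal_toReal hc,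
          ENNReal.ofReal_add (by positivity) (by positivity),
          ENNReal.ofReal_mul (mul_nonneg hC hx), ENNReal.ofReal_mul (mul_nonneg hC hy),
          ENNReal.ofReal_toReal hA', ENNReal.ofReal_toReal hB']
    _ ≤ _ := by
        refine ENNReal.ofReal_le_ofReal ?_
        rw [mul_assoc c.toReal]
        refine mul_le_mul_of_nonneg_left ?_ ENNReal.toReal_nonneg
        have := mul_nonneg (mul_nonneg hC hx) (ENNReal.toReal_nonneg (a := B))
        have := mul_nonneg (mul_nonneg hC hy) (ENNReal.toReal_nonneg (a := A))
        nlinarith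

set_option maxHeartbeats 1000000 in
/-- The scheme converges in `L¹(Ω; H)` with the order that is claimed for the weak error. -/
theorem exists_strong_error_bound (hOb : Bornology.IsBounded O) (hlam : ∀ k, 0 < lam k)
    {Q : L2 O →L[ℝ] L2 O} (hR : R.IsPositive) (hRQ : R ∘L R = Q) [SigmaFinite ν]
    (hν : ∫⁻ σ, ENNReal.ofReal (max |σ| (σ ^ 2)) ∂ν < ∞)
    (V : Ioi (0 : ℝ) → Submodule ℝ (L2 O)) [∀ h, FiniteDimensional ℝ (V h)]
    (hV : ∀ h, V h ≤ (powOp e lam (1 / 2)).domain)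
    (hS1 : ∀ q ∈ Icc (0 : ℝ) 2, ∃ κ₁ > 0, ∀ (h : Ioi (0 : ℝ)) (t : ℝ), 0 < t → ∀ x : L2 O,
      ‖(discreteSemigroup e lam (V h) (hV h) t (proj (V h) x) : L2 O) - semigroup e lam t x‖
        ≤ κ₁ * (h : ℝ) ^ q * t ^ (-q / 2) * ‖x‖)
    (hS2 : ∃ κ₂ > 0, ∀ (h : Ioi (0 : ℝ)) (t : ℝ), 0 < t → ∀ x : L2 O,
      ∃ y : (powOp e lam (1 / 2)).domain,
        (y : L2 O) = (discreteSemigroup e lam (V h) (hV h) t (proj (V h) x) : L2 O)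
          - semigroup e lam t x ∧
        ‖(y : L2 O)‖ + ‖powOp e lam (1 / 2) y‖ ≤ κ₂ * (h : ℝ) * t⁻¹ * ‖x‖)
    {α β : ℝ} (hβ : β ∈ Ioc (α - 1) α)
    (hTr : Summable (fun k => lam k ^ (-α))) (hAQ : IsBoundedComp (powOp e lam β) Q)
    {θ : ℝ} (hθ : θ ∈ Ioc (1 / 2 : ℝ) 1) {T : ℝ} (hT : 1 ≤ T)
    {γ : ℝ} (hγ0 : 0 ≤ γ) (hγ : γ < 1 - α + β) :
    ∃ C : ℝ, 0 < C ∧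
      ∀ (x₀ : L2 O) (Ω : Type*) [MeasurableSpace Ω] (P : Measure Ω) [IsProbabilityMeasure P]
        (π : Ω → Measure (ℝ × EuclideanSpace ℝ (Fin d) × ℝ)),
        IsPoissonRandomMeasure (refMeasure O ν) π P →
      ∀ (b : HilbertBasis ℕ ℝ (L2 O)) (Z : ℕ → ℝ → Ω → ℝ),
        IsImpulsiveCylindrical O ν P π b T Z →
      ∀ X : ℝ → Ω → L2 O, IsMildSolution O ν P π b e lam R T x₀ X →
      ∀ (N : ℕ) (h : Ioi (0 : ℝ)) (Xh : ℕ → Ω → V h), 1 ≤ N → T / N ≤ 1 → (h : ℝ) ≤ 1 →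
        IsDiscreteSolution O P b e lam R Z (V h) (hV h) θ T N x₀ Xh →
        AEStronglyMeasurable (fun ω => (Xh N ω : L2 O)) P ∧ AEStronglyMeasurable (X T) P ∧
        eLpNorm (fun ω => (Xh N ω : L2 O) - X T ω) 1 P
          ≤ ENNReal.ofReal (C * (1 + ‖x₀‖) * ((h : ℝ) ^ (2 * γ) + (T / N) ^ γ)) := by
  have hT0 : 0 < T := by linarith
  have hνfin := lintegral_enorm_ne_top hν
  have hO : volume O ≠ ∞ := hOb.measure_lt_top.ne
  have hp0 : 0 ≤ α - β := by linarith [hβ.2]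
  have hp1 : 0 < 1 - (α - β) := by linarith [hβ.1]
  have hRs : ∀ x y, inner ℝ (R x) y = inner ℝ x (R y) := fun x y => hR.isSymmetric x y
  obtain ⟨κ₁, hκ₁, hs1⟩ := hS1 (2 * γ / (1 - (α - β)))
    ⟨by positivity, by rw [div_le_iff₀ hp1]; linarith⟩
  obtain ⟨κ₁', hκ₁', hs1'⟩ := hS1 (2 * γ) ⟨by positivity, by linarith⟩
  obtain ⟨κ₂, hκ₂, hs2⟩ := hS2
  obtain ⟨C₁, hC₁, hHS⟩ := exists_hs_error_bound (e := e) hθ hlam hβ hγ0 hγ hTr hRs hRQ hAQ hκ₁ hκ₂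
  obtain ⟨C₂, hC₂, hini⟩ := exists_initial_error_bound (e := e) (lam := lam) hθ hT hγ0
    (by linarith) hκ₁'
  obtain ⟨C₃, hC₃, hker⟩ := exists_lintegral_kernel_le (T := T) (C := C₁) (a := γ + (α - β))
    (b := γ + (α - β) / 2) (c := 2 * ((∫⁻ σ, ‖σ‖ₑ ∂ν) * volume O ^ (1 / 2 : ℝ))) hT0.le hC₁.le
    (by linarith) (by linarith)
    (ENNReal.mul_ne_top (by norm_num) (ENNReal.mul_ne_top hνfin
      (ENNReal.rpow_ne_top_of_nonneg (by norm_num) hO)))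
  refine ⟨C₂ + C₃, by positivity, ?_⟩
  intro x₀ Ω _ P _ π hπ b Z hZ X hX N h Xh hN hdt1 hh1 hXh
  obtain ⟨Y, hY, hXY⟩ := hX T ⟨hT0.le, le_rfl⟩
  obtain ⟨J, hJ, hXJ⟩ := hXh
  have hXN := hXJ N le_rfl
  have hh0 : (0 : ℝ) < h := h.2
  have hN0 : (0 : ℝ) < N := by exact_mod_cast hN
  have hdt : 0 < T / N := by positivity
  set L : ℕ → V h →L[ℝ] L2 O := fun k => (V h).subtypeL ∘L
    (stepS e lam (V h) (hV h) θ (T / N) ^ (N - k - 1)) ∘L stepT e lam (V h) (hV h) θ (T / N) with hL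
  set K : ℕ → Ω → L2 O := fun k ω => L k (J k ω) with hKdef
  have hK : ∀ k < N, IsL2Limit P (fun M ω => ∑ m ∈ Finset.range M,
      (Z m ((k + 1) * (T / N)) ω - Z m (k * (T / N)) ω) • L k (proj (V h) (R (b m)))) (K k) := by
    intro k hk
    refine ((hJ k hk).clm (L k)).congr (fun M => ae_of_all _ fun ω => ?_) ae_eq_rfl
    simp [map_sum]
  set κ : ℝ → ℝ := fun s => C₁ * ((h : ℝ) ^ (2 * γ) * (T - s) ^ (-(γ + (α - β)))
      + (T / N) ^ γ * (T - s) ^ (-(γ + (α - β) / 2))) with hκdef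
  have hκ0 : ∀ s ∈ Ioo 0 T, 0 ≤ κ s := by
    intro s hs
    have : 0 ≤ T - s := by linarith [hs.2]
    positivity
  have hLapply : ∀ k x, L k x = ((stepS e lam (V h) (hV h) θ (T / N) ^ (N - k - 1))
      (stepT e lam (V h) (hV h) θ (T / N) x) : L2 O) := fun k x => rfl
  have hκ : ∀ (M : ℕ), ∀ k < N, ∀ s ∈ Ioo 0 T, k * (T / N) < s → s ≤ (k + 1) * (T / N) →
      ∑ m ∈ Finset.range M, ‖L k (proj (V h) (R (b m))) - semigroup e lam (T - s) (R (b m))‖ ^ 2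
        ≤ κ s ^ 2 := by
    intro M k hk s hs hsk hsk'
    -- the remaining time `T - s` lies in the step with number `N - k - 1`
    have hn : ((N - k - 1 : ℕ) : ℝ) = N - k - 1 := by
      have : N - k - 1 + k + 1 = N := by omega
      have : ((N - k - 1 : ℕ) : ℝ) + k + 1 = N := by exact_mod_cast this
      linarith
    have hNT : (N : ℝ) * (T / N) = T := by field_simp
    have ht : 0 < T - s := by linarith [hs.2]
    have hn1 : ((N - k - 1 : ℕ) : ℝ) * (T / N) ≤ T - s := by rw [hn]; linarith
    have hn2 : T - s ≤ (((N - k - 1 : ℕ) : ℝ) + 1) * (T / N) := by rw [hn]; linarith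
    simp_rw [hLapply]
    exact hHS (V h) (hV h) h (T / N) (T - s) (N - k - 1) hh0 hh1 hdt ht hn1 hn2
      (hs1 h (T - s) ht) (hs2 h (T - s) ht) b (Finset.range M)
  have hstoch := eLpNorm_one_sum_increments_sub_integral_le hπ hT0 hZ hνfin hO hN
    (w := fun m k => L k (proj (V h) (R (b m)))) hK hY hκ0 hκ
  rw [← mul_assoc] at hstoch
  have hstoch' := hstoch.trans (hker _ _ (by positivity) (by positivity))
  have hinit := hini (V h) (hV h) h N hh0 hN hdt1 (fun x => hs1' h T hT0 x) x₀
  set x₁ : L2 O := ((stepS e lam (V h) (hV h) θ (T / N) ^ N) (proj (V h) x₀) : L2 O) with hx₁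
  have hXh_eq : (fun ω => (Xh N ω : L2 O)) =ᵐ[P] fun ω => x₁ + (∑ k ∈ Finset.range N, K k) ω := by
    filter_upwards [hXN] with ω hω
    rw [hω, Submodule.coe_add, Submodule.coe_sum, Finset.sum_apply]
    rfl
  have hKm : AEStronglyMeasurable (∑ k ∈ Finset.range N, K k) P :=
    Finset.aestronglyMeasurable_sum _ fun k hk => (hK k (Finset.mem_range.1 hk)).1.1
  have hYm : AEStronglyMeasurable Y P := by
    obtain ⟨_, _, hY2⟩ := hY
    exact hY2.1.1
  refine ⟨(aestronglyMeasurable_const.add hKm).congr hXh_eq.symm,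
    (aestronglyMeasurable_const.add hYm).congr (EventuallyEq.symm hXY), ?_⟩
  have hdiff : (fun ω => (Xh N ω : L2 O) - X T ω) =ᵐ[P]
      (fun _ => x₁ - semigroup e lam T x₀) + (∑ k ∈ Finset.range N, K k - Y) := by
    filter_upwards [hXh_eq, hXY] with ω h1 h2
    rw [h1, h2, Pi.add_apply, Pi.sub_apply]
    abel
  rw [eLpNorm_congr_ae hdiff]
  refine (eLpNorm_add_le aestronglyMeasurable_const (hKm.sub hYm) le_rfl).trans ?_
  have hconst : eLpNorm (fun _ : Ω => x₁ - semigroup e lam T x₀) 1 P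
      ≤ ENNReal.ofReal (C₂ * ((h : ℝ) ^ (2 * γ) + (T / N) ^ γ) * ‖x₀‖) := by
    rw [eLpNorm_one_eq_lintegral_enorm, lintegral_const, measure_univ, mul_one,
      ← ofReal_norm]
    exact ENNReal.ofReal_le_ofReal hinit
  refine (add_le_add hconst hstoch').trans ?_
  rw [← ENNReal.ofReal_add (by positivity) (by positivity)]
  refine ENNReal.ofReal_le_ofReal ?_
  have hs0 : 0 ≤ (h : ℝ) ^ (2 * γ) + (T / N) ^ γ := by positivity
  have := mul_nonneg (mul_nonneg hC₃ (norm_nonneg x₀)) hs0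
  have := mul_nonneg hC₂.le hs0
  nlinarith

/-- The error of a bounded Lipschitz functional is controlled by the `L¹` error. -/
theorem abs_integral_sub_integral_le {H Ω : Type*} [NormedAddCommGroup H] [MeasurableSpace Ω]
    {P : Measure Ω} [IsProbabilityMeasure P] {φ : H → ℝ} {c K r : ℝ} (hc : ∀ x, ‖φ x‖ ≤ c)
    (hφ : Continuous φ) (hK0 : 0 ≤ K) (hK : ∀ x y, ‖φ x - φ y‖ ≤ K * ‖x - y‖) (hr : 0 ≤ r)
    {X Y : Ω → H} (hX : AEStronglyMeasurable X P) (hY : AEStronglyMeasurable Y P)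
    (h : eLpNorm (fun ω => X ω - Y ω) 1 P ≤ ENNReal.ofReal r) :
    |(∫ ω, φ (X ω) ∂P) - ∫ ω, φ (Y ω) ∂P| ≤ K * r := by
  have iX : Integrable (fun ω => φ (X ω)) P :=
    Integrable.of_bound (hφ.comp_aestronglyMeasurable hX) c (ae_of_all _ fun ω => hc _)
  have iY : Integrable (fun ω => φ (Y ω)) P :=
    Integrable.of_bound (hφ.comp_aestronglyMeasurable hY) c (ae_of_all _ fun ω => hc _)
  rw [← integral_sub iX iY, ← Real.norm_eq_abs, ← ENNReal.ofReal_le_ofReal_iff (by positivity),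
    ofReal_norm]
  refine (enorm_integral_le_lintegral_enorm _).trans ?_
  calc ∫⁻ ω, ‖φ (X ω) - φ (Y ω)‖ₑ ∂P ≤ ∫⁻ ω, ENNReal.ofReal K * ‖X ω - Y ω‖ₑ ∂P := by
        refine lintegral_mono fun ω => ?_
        rw [← ofReal_norm, ← ofReal_norm, ← ENNReal.ofReal_mul hK0]
        exact ENNReal.ofReal_le_ofReal (hK _ _)
    _ = ENNReal.ofReal K * ∫⁻ ω, ‖X ω - Y ω‖ₑ ∂P :=
        lintegral_const_mul' _ _ ENNReal.ofReal_ne_top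
    _ ≤ ENNReal.ofReal K * ENNReal.ofReal r := by
        rw [← eLpNorm_one_eq_lintegral_enorm]
        gcongr
    _ = ENNReal.ofReal (K * r) := (ENNReal.ofReal_mul hK0).symm

theorem abs_integral_sub_integral_le_two_mul {H Ω : Type*} [MeasurableSpace Ω]
    {P : Measure Ω} [IsProbabilityMeasure P] {φ : H → ℝ} {c : ℝ} (hc : ∀ x, ‖φ x‖ ≤ c)
    (X Y : Ω → H) : |(∫ ω, φ (X ω) ∂P) - ∫ ω, φ (Y ω) ∂P| ≤ 2 * c := by
  have h : ∀ X : Ω → H, |∫ ω, φ (X ω) ∂P| ≤ c := fun X => by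
    simpa using norm_integral_le_of_norm_le_const (μ := P) (ae_of_all _ fun ω => hc (X ω))
  have := abs_sub (∫ ω, φ (X ω) ∂P) (∫ ω, φ (Y ω) ∂P)
  linarith [h X, h Y]

end Final

end ImpulsiveHeat

theorem theorem2
    {d : ℕ} (O : Set (EuclideanSpace ℝ (Fin d))) (hO : IsOpen O) (hOb : Bornology.IsBounded O)
    -- the operator `A`, its eigenvalues and its eigenbasis
    (A : L2 O →ₗ.[ℝ] L2 O) (hA : IsStrictlyPositiveCompact A)
    (lam : ℕ → ℝ) (e : HilbertBasis ℕ ℝ (L2 O)) (he : IsEigenbasis A lam e)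
    -- the covariance operator `Q` and its nonnegative square root `R = Q^{1/2}`
    (Q R : L2 O →L[ℝ] L2 O) (hQ : Q.IsPositive) (hR : R.IsPositive) (hRQ : R ∘L R = Q)
    -- the jump size intensity
    (ν : Measure ℝ) [SigmaFinite ν] (hν : ∫⁻ σ, ENNReal.ofReal (max |σ| (σ ^ 2)) ∂ν < ∞)
    -- the finite element spaces `V_h ⊆ D(A^{1/2})`, `h > 0`
    (V : Ioi (0 : ℝ) → Submodule ℝ (L2 O)) [∀ h, FiniteDimensional ℝ (V h)]
    (hV : ∀ h, V h ≤ (powOp e lam (1 / 2)).domain)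
    (hS1 : ∀ q ∈ Icc (0 : ℝ) 2, ∃ κ₁ > 0, ∀ (h : Ioi (0 : ℝ)) (t : ℝ), 0 < t → ∀ x : L2 O,
      ‖(discreteSemigroup e lam (V h) (hV h) t (proj (V h) x) : L2 O) - semigroup e lam t x‖
        ≤ κ₁ * (h : ℝ) ^ q * t ^ (-q / 2) * ‖x‖)
    (hS2 : ∃ κ₂ > 0, ∀ (h : Ioi (0 : ℝ)) (t : ℝ), 0 < t → ∀ x : L2 O,
      ∃ y : (powOp e lam (1 / 2)).domain,
        (y : L2 O) = (discreteSemigroup e lam (V h) (hV h) t (proj (V h) x) : L2 O)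
          - semigroup e lam t x ∧
        ‖(y : L2 O)‖ + ‖powOp e lam (1 / 2) y‖ ≤ κ₂ * (h : ℝ) * t⁻¹ * ‖x‖)
    -- the assumptions on `α` and `β`
    (α β : ℝ) (hα : 0 < α) (hβ : β ∈ Ioc (α - 1) α)
    (hTr : Summable (fun k => lam k ^ (-α)))
    (hAQ : IsBoundedComp (powOp e lam β) Q)
    (θ : ℝ) (hθ : θ ∈ Ioc (1 / 2 : ℝ) 1)
    (φ : L2 O → ℝ) (hφ : IsTestFunction e φ)
    (T : ℝ) (hT : 1 ≤ T)
    (γ : ℝ) (hγ : γ < 1 - α + β)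
    (r : ℝ) :
    ∃ C : ℝ, 0 < C ∧
      ∀ x₀ : L2 O, ‖x₀‖ = r →
      ∀ (Ω : Type*) [MeasurableSpace Ω] (P : Measure Ω) [IsProbabilityMeasure P]
        (π : Ω → Measure (ℝ × EuclideanSpace ℝ (Fin d) × ℝ)),
        IsPoissonRandomMeasure (refMeasure O ν) π P →
      ∀ (b : HilbertBasis ℕ ℝ (L2 O)) (Z : ℕ → ℝ → Ω → ℝ),
        IsImpulsiveCylindrical O ν P π b T Z →
      ∀ X : ℝ → Ω → L2 O, IsMildSolution O ν P π b e lam R T x₀ X →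
      ∀ (N : ℕ) (h : Ioi (0 : ℝ)) (Xh : ℕ → Ω → V h), 1 ≤ N → T / N ≤ 1 →
        IsDiscreteSolution O P b e lam R Z (V h) (hV h) θ T N x₀ Xh →
        |(∫ ω, φ (Xh N ω : L2 O) ∂P) - ∫ ω, φ (X T ω) ∂P|
          ≤ C * ((h : ℝ) ^ (2 * γ) + (T / N) ^ γ) := by
  have hlam : ∀ k, 0 < lam k := he.pos hA
  obtain ⟨c, hc⟩ := hφ.bdd
  obtain ⟨K, hK⟩ := hφ.bdd_deriv
  have hc0 : 0 ≤ c := (norm_nonneg _).trans (hc 0)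
  have hK0 : 0 ≤ K := (norm_nonneg _).trans (hK 0)
  have hLip : ∀ x y, ‖φ x - φ y‖ ≤ K * ‖x - y‖ := fun x y =>
    convex_univ.norm_image_sub_le_of_norm_fderiv_le (𝕜 := ℝ)
      (fun z _ => (hφ.contDiff.differentiable (by norm_num)).differentiableAt)
      (fun z _ => hK z) (mem_univ y) (mem_univ x)
  -- If `γ ≤ 0` or `h ≥ 1`, the right-hand side is at least `C`, and `φ` is bounded.
  rcases le_or_gt γ 0 with hγ0 | hγ0
  · refine ⟨2 * c + 1, by positivity, ?_⟩
    intro x₀ _ Ω _ P _ π _ b Z _ X _ N h Xh hN hdt _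
    have hN0 : (0 : ℝ) < N := by exact_mod_cast hN
    have h1 := Real.one_le_rpow_of_pos_of_le_one_of_nonpos (show 0 < T / N by positivity) hdt hγ0
    have h2 : 0 ≤ (h : ℝ) ^ (2 * γ) := Real.rpow_nonneg (le_of_lt h.2) _
    refine (abs_integral_sub_integral_le_two_mul hc _ _).trans ?_
    nlinarith
  · obtain ⟨C, hC, hbound⟩ := exists_strong_error_bound hOb hlam hR hRQ hν V hV hS1 hS2 hβ hTr hAQ
      hθ hT hγ0.le hγ
    refine ⟨2 * c + K * (C * (1 + |r|)) + 1, by positivity, ?_⟩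
    intro x₀ hx₀ Ω _ P _ π hπ b Z hZ X hX N h Xh hN hdt hXh
    have hN0 : (0 : ℝ) < N := by exact_mod_cast hN
    have hh0 : (0 : ℝ) < h := h.2
    have hdt0 : 0 < T / N := by positivity
    have hs1 : 0 ≤ (T / N) ^ γ := by positivity
    have hs2 : 0 ≤ (h : ℝ) ^ (2 * γ) := by positivity
    have hKC : 0 ≤ K * (C * (1 + |r|)) := by positivity
    rcases le_total (h : ℝ) 1 with hh1 | hh1
    · obtain ⟨hm1, hm2, hE⟩ := hbound x₀ Ω P π hπ b Z hZ X hX N h Xh hN hdt hh1 hXh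
      refine (abs_integral_sub_integral_le hc hφ.contDiff.continuous hK0 hLip (by positivity) hm1
        hm2 hE).trans ?_
      rw [hx₀]
      calc K * (C * (1 + r) * ((h : ℝ) ^ (2 * γ) + (T / N) ^ γ))
          ≤ K * (C * (1 + |r|) * ((h : ℝ) ^ (2 * γ) + (T / N) ^ γ)) := by
            gcongr
            exact le_abs_self r
        _ = K * (C * (1 + |r|)) * ((h : ℝ) ^ (2 * γ) + (T / N) ^ γ) := by ring
        _ ≤ _ := mul_le_mul_of_nonneg_right (by linarith) (by positivity)
    · have h1 : 1 ≤ (h : ℝ) ^ (2 * γ) := Real.one_le_rpow hh1 (by positivity)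
      refine (abs_integral_sub_integral_le_two_mul hc _ _).trans ?_
      nlinarith
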